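/- **Setting.** Let $F$ be a countable principal ideal domain and let $s_0,s_1,s_2,\dots\in F$ be non-units with $s_nF+s_mF=F$ for all $n\neq m$. Put $q_0=1$, $q_{n+1}=s_nq_n$. Let $\lambda$ be a regular cardinal with $\aleph_1\le\lambda\le 2^{\aleph_0}$. *Forest.* Let $(C_\alpha)_{\alpha<\lambda}$ be infinite subsets of $\omega$ with $C_\alpha\cap C_\beta$ finite for $\alpha\ne\beta$. For $\alpha<\lambda$ let $T_\alpha$ be a subtree (a set closed under initial segments) of the tree of all finite sequences $\tau:n\to 2$ $(n\in\omega)$ with $\tau(e)=0$ for every $e<n$ with $e\notin C_\alpha$; the trees $T_\alpha$ are regarded as pairwise disjoint. Let $V_\alpha$ be a set of infinite branches $\eta:\omega\to 2$ of $T_\alpha$ (that is, $\eta\upharpoonright n\in T_\alpha$ for all $n$) with $|V_\alpha|=\lambda$. *Base algebra.* Let $B=F[z_\tau:\tau\in\bigcup_{\alpha<\lambda}T_\alpha]$ be the polynomial ring, let $\widehat B=\varprojlim_n B/q_nB$ be its completion in the topology with the neighbourhoods $q_nB$ of $0$, and let $E=Q\otimes_F\widehat B$, where $Q$ is the field of fractions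 of $F$. For $\eta\in V_\alpha$, $n\in\omega$ and $x\in E$ put $$y_{\eta nx}=\frac1{q_n}\Big(\sum_{i\ge n}q_i\,z_{\eta\upharpoonright i}+x\sum_{i\ge n}q_i\,\eta(i)\Big)\in E,$$ where the two series converge in $\widehat B$ and $z_{\eta\upharpoonright i}$ refers to the node $\eta\upharpoonright i$ of $T_\alpha$. *The chain.* Let $(b_\alpha)_{\alpha<\lambda}$ be a sequence in which every non-zero element $b\in B$ of the form $b=\sum_{m\in M}m$, with $M$ a finite set of monomials and $Fb$ pure in $B$, occurs exactly $\lambda$ times, and no other element occurs. For $b\in B$ let $\|b\|$ be the least $\beta<\lambda$ such that $b\in F[z_\tau:\tau\in T_\gamma,\ \gamma<\beta]$. Define $F$-submodules $R_\alpha$ of $E$ and elements $x_\alpha\in E$ by recursion: $R_0=\{0\}$; $R_1=F$; $R_\alpha=\bigcup_{\beta<\alpha}R_\beta$ for limit ordinals $\alpha\le\lambda$; and $$R_{\alpha+1}=R_\alpha[\,y_{\eta nx_\alpha},z_\tau:\eta\in V_\alpha,\ \tau\in T_\alpha,\ n\in\omega\,]\qquad(1\le\alpha<\lambda),$$ where $x_\alpha=b_\alpha$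 if $b_\alpha\in R_\alpha$ and $\|b_\alpha\|\le\alpha$, and $x_\alpha=0$ otherwise $(\alpha<\lambda)$. Put $R=R_\lambda$, and for $\alpha<\lambda$ let $$G_\alpha=\big\langle\, y_{\eta nx_\alpha},\ z_\tau:\eta\in V_\alpha,\ \tau\in T_\alpha,\ n\in\omega\,\big\rangle_F$$ be the $F$-submodule of $E$ generated by these elements. **Proposition.** For every $\alpha<\lambda$ we have $x_\alpha\in G_\alpha$, and every $F$-homomorphism $h:G_\alpha\to R$ satisfies $h(x_\alpha)\in x_\alpha R$. -/

import Mathlib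

open scoped TensorProduct

noncomputable section

namespace ERing

/-! ### Trees and the forest -/

/-- A finite branch `τ : n ⟶ 2`; its length is the first component. -/
abbrev FinBranch : Type := Σ n : ℕ, (Fin n → Bool)

/-- The initial segment `η ↾ n` of an infinite branch `η : ω ⟶ 2`. -/
def restrict (η : ℕ → Bool) (n : ℕ) : FinBranch := ⟨n, fun i => η i⟩

/-- The tree `T_C` of the finite branches that vanish outside `C`. -/
def treeOn (C : Set ℕ) : Set FinBranch :=
  {τ | ∀ e : Fin τ.1, (e : ℕ) ∉ C → τ.2 e = false}

/-- A set of finite branches is a subtree if it is closed under initial segments. -/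
def IsSubtree (T : Set FinBranch) : Prop :=
  ∀ τ ∈ T, ∀ (m : ℕ) (h : m ≤ τ.1), (⟨m, fun i => τ.2 (Fin.castLE h i)⟩ : FinBranch) ∈ T

/-- The infinite branches of a tree. -/
def Br (T : Set FinBranch) : Set (ℕ → Bool) := {η | ∀ n, restrict η n ∈ T}

/-- The ordinals `α < lam`. -/
abbrev Index (lam : Cardinal.{0}) : Type 1 := Set.Iio lam.ord

/-- The combinatorial choices: pairwise almost disjoint infinite sets `C α ⊆ ω`, for each of them a
subtree `T α` of the tree on `C α` (the whole tree, or a perfect subtree of it, for example), and a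
set `V α` of `lam` infinite branches of `T α`, for all `α < lam`. -/
structure Forest (lam : Cardinal.{0}) where
  C : Index lam → Set ℕ
  C_infinite : ∀ α, (C α).Infinite
  C_almost_disjoint : ∀ α β, α ≠ β → (C α ∩ C β).Finite
  T : Index lam → Set FinBranch
  T_subtree : ∀ α, IsSubtree (T α)
  T_subset : ∀ α, T α ⊆ treeOn (C α)
  V : Index lam → Set (ℕ → Bool)
  V_subset : ∀ α, V α ⊆ Br (T α)
  V_card : ∀ α, Cardinal.mk (V α) = lam

/-- The nodes of the forest: the disjoint union of the trees `T α`. -/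
abbrev Forest.Node {lam : Cardinal.{0}} (𝔉 : Forest lam) : Type 1 := Σ α : Index lam, 𝔉.T α

/-- The node `η ↾ n` of the tree `T α`, for `η ∈ V α`. -/
def Forest.node {lam : Cardinal.{0}} (𝔉 : Forest lam) (α : Index lam) (η : 𝔉.V α) (n : ℕ) :
    𝔉.Node :=
  ⟨α, ⟨restrict η.1 n, 𝔉.V_subset α η.2 n⟩⟩

/-! ### The base algebra and its completion -/

section Algebra

variable {F : Type*} [CommRing F]

/-- `q 0 = 1`, `q (n + 1) = s n * q n`. -/
def q (s : ℕ → F) : ℕ → F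
  | 0 => 1
  | n + 1 => s n * q s n

theorem q_dvd (s : ℕ → F) (n : ℕ) : q s n ∣ q s (n + 1) := Dvd.intro_left (s n) rfl

variable {lam : Cardinal.{0}}

/-- The base algebra `F[z_τ]`, with one variable `z_τ` for each node `τ` of the forest. -/
abbrev BaseAlg (F : Type*) [CommRing F] (𝔉 : Forest lam) : Type _ := MvPolynomial 𝔉.Node F

/-- The ideal `q_n B` of the base algebra `B`. -/
def qIdeal (s : ℕ → F) (𝔉 : Forest lam) (n : ℕ) : Ideal (BaseAlg F 𝔉) :=
  Ideal.span {algebraMap F (BaseAlg F 𝔉) (q s n)}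

theorem qIdeal_succ_le (s : ℕ → F) (𝔉 : Forest lam) (n : ℕ) :
    qIdeal s 𝔉 (n + 1) ≤ qIdeal s 𝔉 n :=
  Ideal.span_singleton_le_span_singleton.mpr (map_dvd _ (q_dvd s n))

/-- The completion of the base algebra `B` in the topology with the neighbourhoods `q_n B` of zero:
the inverse limit of the algebras `B / q_n B`. -/
def Completion (s : ℕ → F) (𝔉 : Forest lam) :
    Subalgebra F (∀ n, BaseAlg F 𝔉 ⧸ qIdeal s 𝔉 n) where
  carrier := {f | ∀ n, Ideal.Quotient.factor (qIdeal_succ_le s 𝔉 n) (f (n + 1)) = f n}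
  mul_mem' := by
    intro a b ha hb n
    rw [Pi.mul_apply, Pi.mul_apply, map_mul, ha n, hb n]
  add_mem' := by
    intro a b ha hb n
    rw [Pi.add_apply, Pi.add_apply, map_add, ha n, hb n]
  algebraMap_mem' := fun _ _ => rfl

/-- The canonical map of the base algebra into its completion. -/
def toCompletion (s : ℕ → F) (𝔉 : Forest lam) (b : BaseAlg F 𝔉) : Completion s 𝔉 :=
  ⟨fun n => Ideal.Quotient.mk (qIdeal s 𝔉 n) b, fun _ => rfl⟩

/-- The sum of the convergent series `∑_i q_i c_i` in the completion, for `c_i` in the base algebra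
`B`: modulo `q_k B` all terms with `i ≥ k` vanish. -/
def series (s : ℕ → F) (𝔉 : Forest lam) (c : ℕ → BaseAlg F 𝔉) : Completion s 𝔉 :=
  ⟨fun k => Ideal.Quotient.mk (qIdeal s 𝔉 k) (∑ i ∈ Finset.range k, q s i • c i), by
    intro k
    rw [Ideal.Quotient.factor_mk, Finset.sum_range_succ, map_add, add_eq_left,
      Ideal.Quotient.eq_zero_iff_mem, Algebra.smul_def]
    exact Ideal.mul_mem_right _ _ (Ideal.subset_span rfl)⟩

/-- The completion with scalars extended to the fraction field of `F`, that is, with all nonzero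
elements of `F` inverted. -/
abbrev Ambient (s : ℕ → F) (𝔉 : Forest lam) : Type _ := FractionRing F ⊗[F] Completion s 𝔉

/-- The canonical map of the completion into its extension of scalars. -/
def ofCompletion (s : ℕ → F) (𝔉 : Forest lam) (g : Completion s 𝔉) : Ambient s 𝔉 :=
  (1 : FractionRing F) ⊗ₜ[F] g

/-- The image of an element of the base algebra. -/
def ofBase (s : ℕ → F) (𝔉 : Forest lam) (b : BaseAlg F 𝔉) : Ambient s 𝔉 :=
  ofCompletion s 𝔉 (toCompletion s 𝔉 b)

/-- The element `z_τ`. -/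
def z (s : ℕ → F) (𝔉 : Forest lam) (τ : 𝔉.Node) : Ambient s 𝔉 :=
  ofBase s 𝔉 (MvPolynomial.X τ)

variable [IsDomain F]

/-- The branch-like element
`y_{η n x} = (1 / q_n) (∑_{i ≥ n} q_i z_{η ↾ i} + x ∑_{i ≥ n} q_i η(i))`. -/
def y (s : ℕ → F) (𝔉 : Forest lam) (α : Index lam) (η : 𝔉.V α) (n : ℕ) (x : Ambient s 𝔉) :
    Ambient s 𝔉 :=
  (algebraMap F (FractionRing F) (q s n))⁻¹ •
    (ofCompletion s 𝔉
        (series s 𝔉 fun i => if n ≤ i then MvPolynomial.X (𝔉.node α η i) else 0) +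
      x * ofCompletion s 𝔉
        (series s 𝔉 fun i => if n ≤ i ∧ η.1 i = true then 1 else 0))

/-- The set `{y_{η n x}, z_τ : η ∈ V α, τ ∈ T α, n ∈ ω}`. -/
def gens (s : ℕ → F) (𝔉 : Forest lam) (α : Index lam) (x : Ambient s 𝔉) : Set (Ambient s 𝔉) :=
  {g | ∃ (η : 𝔉.V α) (n : ℕ), g = y s 𝔉 α η n x} ∪ {g | ∃ τ : 𝔉.T α, g = z s 𝔉 ⟨α, τ⟩}

/-! ### The sequence `b` and the norm -/

/-- The nonzero pure elements `b = ∑_{m ∈ M} m` of the base algebra, where `M` is a finite set of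
monomials. Purity of `b` means purity of the submodule `F b`. -/
def Admissible {𝔉 : Forest lam} (b : BaseAlg F 𝔉) : Prop :=
  b ≠ 0 ∧
  (∀ (f : F) (c : BaseAlg F 𝔉), f ≠ 0 → f • c ∈ Submodule.span F {b} → c ∈ Submodule.span F {b}) ∧
  ∃ M : Finset (𝔉.Node →₀ ℕ), b = ∑ m ∈ M, MvPolynomial.monomial m 1

/-- The sequence `b` runs `lam` times through the admissible elements. -/
def IsEnumeration {𝔉 : Forest lam} (b : Index lam → BaseAlg F 𝔉) : Prop :=
  (∀ α, Admissible (b α)) ∧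
  ∀ c : BaseAlg F 𝔉, Admissible c →
    Cardinal.mk {α : Index lam // b α = c} = Cardinal.lift.{1} lam

/-- The norm `‖b‖` of an element `b` of the base algebra: the least `β < lam` such that all
monomials in the support of `b` are products of variables `z_τ` with `τ ∈ T γ` for some `γ < β`. -/
def norm {𝔉 : Forest lam} (b : BaseAlg F 𝔉) : Ordinal.{0} :=
  sInf {β | β < lam.ord ∧ ∀ m ∈ b.support, ∀ τ ∈ m.support, τ.1.1 < β}

/-! ### The chain `R_α` -/

open Classical in
/-- The element `x_α`, computed from `R_α`: it is `b_α` if `b_α ∈ R_α` and `‖b_α‖ ≤ α`, and `0`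
otherwise. -/
def xOf (s : ℕ → F) (𝔉 : Forest lam) (b : Index lam → BaseAlg F 𝔉) (α : Index lam)
    (Rα : Submodule F (Ambient s 𝔉)) : Ambient s 𝔉 :=
  if ofBase s 𝔉 (b α) ∈ Rα ∧ norm (b α) ≤ α.1 then ofBase s 𝔉 (b α) else 0

open Classical in
/-- The chain `R_0 = {0}`, `R_1 = F`, `R_{α + 1} = R_α [y_{η n x_α}, z_τ]` for `1 ≤ α < lam`, and
`R_α = ⋃_{β < α} R_β` for limit ordinals `α` (the supremum of an ascending chain of submodules is
its union). It is only used for `α ≤ lam`. -/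
def chain (s : ℕ → F) (𝔉 : Forest lam) (b : Index lam → BaseAlg F 𝔉) (o : Ordinal.{0}) :
    Submodule F (Ambient s 𝔉) :=
  Ordinal.limitRecOn o
    ⊥
    (fun α Rα =>
      if α = 0 then Subalgebra.toSubmodule ⊥
      else if h : α < lam.ord then
        Subalgebra.toSubmodule (Algebra.adjoin F
          ((Rα : Set (Ambient s 𝔉)) ∪ gens s 𝔉 ⟨α, h⟩ (xOf s 𝔉 b ⟨α, h⟩ Rα)))
      else Rα)
    (fun α _ Rbelow => ⨆ (β : Ordinal.{0}) (h : β < α), Rbelow β h)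

/-- The algebra `R = R_lam`. -/
def R (s : ℕ → F) (𝔉 : Forest lam) (b : Index lam → BaseAlg F 𝔉) : Submodule F (Ambient s 𝔉) :=
  chain s 𝔉 b lam.ord

/-- The elements `x_α`. -/
def x (s : ℕ → F) (𝔉 : Forest lam) (b : Index lam → BaseAlg F 𝔉) (α : Index lam) : Ambient s 𝔉 :=
  xOf s 𝔉 b α (chain s 𝔉 b α.1)

/-- The submodule `G_α`, generated over `F` by all `y_{η n x_α}` and `z_τ` with `η ∈ V α`,
`n ∈ ω`, `τ ∈ T α`. -/
def G (s : ℕ → F) (𝔉 : Forest lam) (b : Index lam → BaseAlg F 𝔉) (α : Index lam) :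
    Submodule F (Ambient s 𝔉) :=
  Submodule.span F (gens s 𝔉 α (x s 𝔉 b α))

end Algebra

end ERing

end

/-!
The recursion `y_{η n x} = s_n y_{η (n+1) x} + z_{η ↾ n} + x η(n)` gives `x ∈ G_α` as soon as some
branch in `V α` takes the value `1`.

Elements of `R` are polynomials over the base algebra `B` in branch elements `y_{η N x_β}` of a
common index `N`, and these are algebraically independent (`evalAt_injective`). The reason, which
also drives the main argument, is that modulo `s_n` such a branch element is the partial sum
`∑_{N ≤ i ≤ n} (q_i / q_N) (z_{η ↾ i} + x_β η(i))`, in which the node `z_{η ↾ n}` has a unit as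
coefficient. So the nodes of a large level `n` can be solved for, and a polynomial in branch
elements that vanishes modulo `s_n` vanishes coefficientwise (`rename_mem_map_C`), once branches
that agree below `n` are identified.

Let `h : G_α → R` and let `g` be the polynomial that represents `h(x)`. If some coefficient of `g`
is not a multiple of `x`, an `F`-linear functional `l` on `B` kills `x B` but not this coefficient;
it exists since the nonzero coefficients of `x` are all `1`, so that division by `x` with remainder is
possible (`exists_functional`). As `V α` is uncountable and `F` is countable, uncountably many of
the polynomials `p_η` that represent `h(y_{η 0 x})` agree in their index `N`, in a bound for the
levels to avoid, and in the value of `l` at the coefficient in question. Two such branches `η`, `ρ`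
split at an arbitrarily large `n`, where `y_{η 0 x} - y_{ρ 0 x} = q_n x` modulo `s_n`. Hence
`p_η - p_ρ - q_n g` vanishes modulo `s_n`. By almost disjointness no branch in another tree
`T β` involved takes the value `1` at `n`, so that up to multiples of `x` all the partial sums
depend only on the nodes of level `n`, and the relation holds coefficientwise modulo `x` and `s_n`
(`coeff_sub_coeff_mem`). Applying `l` shows that `s_n` divides a fixed nonzero element of `F`, for
arbitrarily large `n`, which is impossible for pairwise coprime non-units. So `x` divides `g`
(`exists_evalAt_eq_dvd`).

The quotient may still involve the tree of index `0`, whose nodes are not adjoined in the chain.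
The retraction of the ambient algebra that kills these nodes fixes `R` pointwise and maps the
quotient into `R`.
-/

noncomputable section

namespace ERing

open MvPolynomial Finset

/-! ### Coprime sequences -/

section Coprime

theorem seq_ne_zero {F : Type*} [CommRing F] {s : ℕ → F} (hu : ∀ n, ¬ IsUnit (s n))
    (hs : ∀ n m, n ≠ m → IsCoprime (s n) (s m)) (n : ℕ) : s n ≠ 0 := by
  intro h
  have := hs n (n + 1) (by omega)
  rw [h, isCoprime_zero_left] at this
  exact hu _ this

variable {F : Type*} [CommRing F] [IsDomain F] [IsPrincipalIdealRing F] {s : ℕ → F}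

/-- Each prime divisor of `c` divides at most one member of a pairwise coprime sequence. -/
theorem eventually_isCoprime (hs : ∀ n m, n ≠ m → IsCoprime (s n) (s m)) {c : F} (hc : c ≠ 0) :
    ∀ᶠ n in Filter.atTop, IsCoprime (s n) c := by
  induction c using UniqueFactorizationMonoid.induction_on_prime with
  | h₁ => exact absurd rfl hc
  | h₂ a ha => exact Filter.Eventually.of_forall fun n => isCoprime_one_right.mono dvd_rfl ha.dvd
  | h₃ a p ha hp ih =>
    have hpn : ∀ᶠ n in Filter.atTop, IsCoprime (s n) p := by
      by_cases h : ∃ k, p ∣ s k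
      · obtain ⟨k, hk⟩ := h
        filter_upwards [Filter.eventually_gt_atTop k] with n hn
        exact (hs n k hn.ne').of_isCoprime_of_dvd_right hk
      · push Not at h
        exact Filter.Eventually.of_forall fun n =>
          ((Irreducible.coprime_iff_not_dvd hp.irreducible).2 (h n)).symm
    filter_upwards [ih ha, hpn] with n h1 h2
    exact h2.mul_right h1

theorem eventually_not_dvd (hu : ∀ n, ¬ IsUnit (s n))
    (hs : ∀ n m, n ≠ m → IsCoprime (s n) (s m)) {c : F} (hc : c ≠ 0) :
    ∀ᶠ n in Filter.atTop, ¬ s n ∣ c := by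
  filter_upwards [eventually_isCoprime hs hc] with n hn hd
  exact hu n (isCoprime_self.1 (hn.of_isCoprime_of_dvd_right hd))

end Coprime

/-! ### Functionals separating a principal ideal -/

section Functional

variable {F : Type*} [CommRing F] {ι : Type*}

/-- Division with remainder by a polynomial whose leading coefficient is a unit splits the
polynomial ring, as an `F`-module, into the ideal of multiples and the module of remainders. -/
theorem exists_functional [Nontrivial F] {x : MvPolynomial ι F} (hx : x ≠ 0)
    (h1 : ∀ m ∈ x.support, coeff m x = 1)
    {b : MvPolynomial ι F} (hb : ¬ x ∣ b) :
    ∃ l : MvPolynomial ι F →ₗ[F] F, (∀ a, l (x * a) = 0) ∧ l b ≠ 0 := by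
  classical
  let _ : LinearOrder ιᵒᵈ := linearOrderOfSTO (WellOrderingRel (α := ιᵒᵈ))
  let _ : LinearOrder ι := inferInstanceAs (LinearOrder ιᵒᵈᵒᵈ)
  have : WellFoundedLT ιᵒᵈ := ⟨(WellOrderingRel.isWellOrder (α := ιᵒᵈ)).wf⟩
  have : WellFoundedGT ι := inferInstanceAs (WellFoundedGT ιᵒᵈᵒᵈ)
  let M : MonomialOrder ι := MonomialOrder.lex
  have hlc : M.leadingCoeff x = 1 := h1 _ (M.degree_mem_support hx)
  let p : Submodule F (MvPolynomial ι F) := LinearMap.range (LinearMap.mulLeft F x)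
  let q : Submodule F (MvPolynomial ι F) :=
    { carrier := {r | ∀ c, M.degree x ≤ c → coeff c r = 0}
      add_mem' := fun ha hb c hc => by rw [coeff_add, ha c hc, hb c hc, add_zero]
      zero_mem' := fun c _ => coeff_zero c
      smul_mem' := fun f a ha c hc => by rw [coeff_smul, ha c hc, smul_zero] }
  have hpq : IsCompl p q := by
    constructor
    · rw [Submodule.disjoint_def]
      rintro _ ⟨a, rfl⟩ hq
      by_contra hne
      have ha : a ≠ 0 := by rintro rfl; simp at hne
      have hlc' : M.leadingCoeff x * M.leadingCoeff a ≠ 0 := by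
        rw [hlc, one_mul]; exact M.leadingCoeff_ne_zero_iff.2 ha
      have := hq (M.degree x + M.degree a) le_self_add
      rw [LinearMap.mulLeft_apply, M.coeff_mul_of_degree_add] at this
      exact hlc' this
    · rw [codisjoint_iff, eq_top_iff]
      rintro f -
      obtain ⟨g, r, rfl, -, hr⟩ := M.div_single (b := x) (by rw [hlc]; exact isUnit_one) f
      refine Submodule.add_mem_sup ⟨g, by simp [mul_comm]⟩ fun c hc => ?_
      by_contra h
      exact hr c (mem_support_iff.2 h) hc
  obtain ⟨a, ha, r, hr, rfl⟩ := Submodule.mem_sup.1 (hpq.sup_eq_top ▸ Submodule.mem_top (x := b))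
  have hr0 : r ≠ 0 := by
    rintro rfl
    obtain ⟨a, rfl⟩ := ha
    exact hb ⟨a, by simp⟩
  obtain ⟨c, hc⟩ := ne_zero_iff.1 hr0
  refine ⟨(lcoeff F c).comp (q.subtype.comp (q.projectionOnto p hpq.symm)), fun d => ?_, ?_⟩
  · have : x * d ∈ p := ⟨d, rfl⟩
    simp [(Submodule.projection_apply_eq_zero_iff hpq.symm).2 this]
  · simpa [(Submodule.projection_apply_eq_zero_iff hpq.symm).2 ha,
      Submodule.projection_apply_of_mem_left hpq.symm hr] using hc

end Functional

/-! ### Unfolding the branch elements -/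

section Unfold

variable {F : Type*} [CommRing F] {Nd Br : Type*}

theorem ringHom_congr {σ A S : Type*} [CommRing A] [CommRing S] (φ ψ : MvPolynomial σ A →+* S)
    (p : MvPolynomial σ A) (hC : ∀ m, φ (C (coeff m p)) = ψ (C (coeff m p)))
    (hX : ∀ i ∈ p.vars, φ (X i) = ψ (X i)) : φ p = ψ p := by
  rw [p.as_sum, map_sum, map_sum]
  refine Finset.sum_congr rfl fun m hm => ?_
  rw [monomial_eq, map_mul, map_mul, hC, Finsupp.prod, map_prod, map_prod]
  congr 1
  refine Finset.prod_congr rfl fun i hi => ?_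
  rw [map_pow, map_pow, hX i ((mem_vars_iff_mem_support i).2 ⟨m, hm, hi⟩)]

/-- If `f` is injective on the variables of `p` and of the monomial `m`, then `rename f` carries the
coefficient of `p` at `m` to the image of `m`. -/
theorem coeff_rename_mapDomain_of_injOn {σ τ A : Type*} [CommRing A] (f : σ → τ)
    (p : MvPolynomial σ A) (m : σ →₀ ℕ) (hf : Set.InjOn f (p.vars ∪ m.support : Set σ)) :
    coeff (m.mapDomain f) (rename f p) = coeff m p := by
  classical
  conv_lhs => rw [p.as_sum]
  simp only [map_sum, rename_monomial, coeff_sum, coeff_monomial]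
  rw [Finset.sum_eq_single m]
  · simp
  · intro u hu hne
    refine if_neg fun h => hne (Finsupp.mapDomain_injOn _ hf ?_ ?_ h)
    · exact fun i hi => Or.inl (mem_coe.2 ((mem_vars_iff_mem_support i).2 ⟨u, hu, hi⟩))
    · exact fun i hi => Or.inr hi
  · intro h
    simpa using h

/-- The product `s_N ⋯ s_{i-1}`, that is, `q_i / q_N`. -/
def seg (s : ℕ → F) (N i : ℕ) : F := ∏ l ∈ Ico N i, s l

theorem seg_succ (s : ℕ → F) {N i : ℕ} (h : N ≤ i) : seg s N (i + 1) = seg s N i * s i :=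
  prod_Ico_succ_top h _

theorem seg_mul_seg (s : ℕ → F) {N n L : ℕ} (h : N ≤ n) (h' : n ≤ L) :
    seg s N n * seg s n L = seg s N L :=
  prod_Ico_consecutive _ h h'

theorem q_eq_seg (s : ℕ → F) (n : ℕ) : q s n = seg s 0 n := by
  induction n with
  | zero => simp [q, seg]
  | succ n ih => rw [q, ih, seg_succ s (Nat.zero_le n), mul_comm]

theorem isCoprime_seg {s : ℕ → F} (hs : ∀ n m, n ≠ m → IsCoprime (s n) (s m)) (N n : ℕ) :
    IsCoprime (seg s N n) (s n) :=
  IsCoprime.prod_left fun _ hi => hs _ _ (Finset.mem_Ico.1 hi).2.ne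

variable (s : ℕ → F) (node : ℕ → Br → Nd) (δ : ℕ → Br → MvPolynomial Nd F)

/-- The partial sum `∑_{N ≤ i < L} (q_i / q_N) (z_{η ↾ i} + δ_i(η))` of a branch element. -/
def part (N L : ℕ) (η : Br) : MvPolynomial Nd F :=
  ∑ i ∈ Ico N L, C (seg s N i) * (X (node i η) + δ i η)

theorem part_succ {N n : ℕ} (h : N ≤ n) (η : Br) : part s node δ N (n + 1) η =
    part s node δ N n η + C (seg s N n) * (X (node n η) + δ n η) :=
  sum_Ico_succ_top h _

theorem part_add {N n L : ℕ} (h : N ≤ n) (h' : n ≤ L) (η : Br) : part s node δ N L η =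
    part s node δ N n η + C (seg s N n) * part s node δ n L η := by
  rw [part, part, part, ← sum_Ico_consecutive _ h h', mul_sum]
  congr 1
  refine sum_congr rfl fun i hi => ?_
  rw [← mul_assoc, ← C_mul, seg_mul_seg s h (mem_Ico.1 hi).1]

/-- The change of variables which expresses the branch elements of index `N` by those of
index `L`. -/
def shift (N L : ℕ) : MvPolynomial Br (MvPolynomial Nd F) →+* MvPolynomial Br (MvPolynomial Nd F) :=
  eval₂Hom C fun η => C (C (seg s N L)) * X η + C (part s node δ N L η)

theorem eval_zero_shift (N L : ℕ) (p : MvPolynomial Br (MvPolynomial Nd F)) :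
    eval 0 (shift s node δ N L p) = eval (part s node δ N L) p := by
  have : (eval 0).comp (shift s node δ N L) = eval (part s node δ N L) := by
    apply MvPolynomial.ringHom_ext <;> intros <;> simp [shift]
  exact DFunLike.congr_fun this p

theorem eval_sub_eval_mem {σ A : Type*} [CommRing A] (J : Ideal A) (f g : σ → A)
    (h : ∀ i, f i - g i ∈ J) (p : MvPolynomial σ A) : eval f p - eval g p ∈ J := by
  rw [← Ideal.Quotient.eq]
  refine ringHom_congr ((Ideal.Quotient.mk J).comp (eval f)) ((Ideal.Quotient.mk J).comp (eval g)) p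
    (fun m => by simp) fun i _ => ?_
  simpa [Ideal.Quotient.eq] using h i

/-- Beyond index `n`, all terms of a branch element are divisible by `s_n`. -/
theorem eval_part_mem_of_shift {N n L : ℕ} (hN : N ≤ n) (hL : n + 1 ≤ L)
    {p p' : MvPolynomial Br (MvPolynomial Nd F)}
    (h : shift s node δ N L p = C (C (s n)) * p') :
    eval (part s node δ N (n + 1)) p ∈ Ideal.span {(C (s n) : MvPolynomial Nd F)} := by
  have h1 : eval (part s node δ N L) p ∈ Ideal.span {(C (s n) : MvPolynomial Nd F)} := by
    rw [← eval_zero_shift, h, map_mul, eval_C]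
    exact Ideal.mul_mem_right _ _ (Ideal.mem_span_singleton_self _)
  refine (Submodule.sub_mem_iff_right _ h1).1 (eval_sub_eval_mem _ _ _ (fun η => ?_) p)
  rw [part_add s node δ (by omega : N ≤ n + 1) hL, add_sub_cancel_left, seg_succ s hN, C_mul,
    mul_assoc, mul_left_comm]
  exact Ideal.mul_mem_right _ _ (Ideal.mem_span_singleton_self _)

/-- Modulo `s_n`, a branch element is a unit times its node of level `n` plus terms of lower level,
so that the nodes of level `n` can be replaced by independent variables: a polynomial in the branch
elements that vanishes modulo `s_n` vanishes identically, after the branches are identified that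
agree up to level `n`. This also holds modulo an ideal `J` containing `s_n`, and it suffices that
modulo `J` the remaining terms of a branch element depend, through `w`, only on its node of
level `n`. -/
theorem rename_mem_map_C {J : Ideal (MvPolynomial Nd F)} {N n : ℕ} (hN : N ≤ n)
    (hsJ : C (s n) ∈ J) (lev : Nd → ℕ) (hlev : ∀ i η, lev (node i η) = i)
    {p : MvPolynomial Br (MvPolynomial Nd F)}
    (hcoeff : ∀ m, ∀ τ ∈ (coeff m p).vars, lev τ ≠ n)
    (hδ : ∀ η ∈ p.vars, ∀ i, ∀ τ ∈ (δ i η).vars, lev τ ≠ n)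
    {u : F} (hu : C (u * seg s N n) - 1 ∈ J) (w : Nd → MvPolynomial Nd F)
    (hw : ∀ η ∈ p.vars, C (seg s N n) * w (node n η) -
      (part s node δ N n η + C (seg s N n) * δ n η) ∈ J)
    (hp : eval (part s node δ N (n + 1)) p ∈ Ideal.span {(C (s n) : MvPolynomial Nd F)}) :
    rename (node n) p ∈ J.map (C : _ →+* MvPolynomial Nd (MvPolynomial Nd F)) := by
  classical
  let A : MvPolynomial Nd F →+* MvPolynomial Nd (MvPolynomial Nd F) :=
    eval₂Hom (C.comp C) fun τ => if lev τ = n then C (C u) * X τ - C (w τ) else C (X τ)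
  have hA : ∀ b : MvPolynomial Nd F, (∀ τ ∈ b.vars, lev τ ≠ n) → A b = C b := fun b hb =>
    ringHom_congr A C b (fun m => by simp [A]) fun τ hτ => by simp [A, hb τ hτ]
  have hAX : ∀ η, A (X (node n η)) = C (C u) * X (node n η) - C (w (node n η)) := fun η => by
    simp [A, hlev]
  have hC : ∀ {a : MvPolynomial Nd F}, a ∈ J → C a ∈ J.map (C : _ →+* MvPolynomial Nd _) :=
    fun ha => Ideal.mem_map_of_mem _ ha
  have h1 : A (eval (part s node δ N (n + 1)) p) ∈ J.map (C : _ →+* MvPolynomial Nd _) := by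
    obtain ⟨t, ht⟩ := Ideal.mem_span_singleton'.1 hp
    rw [← ht, map_mul, show A (C (s n)) = C (C (s n)) by simp [A]]
    exact Ideal.mul_mem_left _ _ (hC hsJ)
  rw [← Ideal.Quotient.eq_zero_iff_mem] at h1 ⊢
  rw [← h1]
  set K := J.map (C : _ →+* MvPolynomial Nd (MvPolynomial Nd F))
  refine (ringHom_congr (S := _ ⧸ K) ((Ideal.Quotient.mk K).comp (A.comp (eval (part s node δ N (n + 1)))))
    ((Ideal.Quotient.mk K).comp (rename (node n)).toRingHom) p (fun m => ?_) fun η hη => ?_).symm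
  · simp [hA _ (hcoeff m)]
  · simp only [RingHom.comp_apply, eval_X, AlgHom.toRingHom_eq_coe, RingHom.coe_coe, rename_X]
    rw [Ideal.Quotient.eq, part_succ s node δ hN, map_add, map_mul, map_add, hAX,
      hA (δ n η) (hδ η hη n), hA (part s node δ N n η), show A (C (seg s N n)) = C (C (seg s N n)) by
        simp [A]]
    · have := Ideal.sub_mem _ (Ideal.mul_mem_right (X (node n η)) _ (hC hu)) (hC (hw η hη))
      convert this using 1
      simp only [map_sub, map_add, map_mul, map_one]
      ring
    · intro τ hτ hn
      rw [part] at hτ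
      obtain ⟨i, hi, hτ⟩ := Finset.mem_biUnion.1 (vars_sum_subset _ _ hτ)
      rcases Finset.mem_union.1 (vars_mul _ _ hτ) with h | h
      · simp at h
      rcases Finset.mem_union.1 (vars_add_subset _ _ h) with h | h
      · rcases subsingleton_or_nontrivial F with hF | hF
        · rw [Subsingleton.elim (X (node i η) : MvPolynomial Nd F) 0] at h
          simp at h
        rw [vars_X, Finset.mem_singleton] at h
        rw [h, hlev] at hn
        exact (Finset.mem_Ico.1 hi).2.ne hn
      · exact hδ η hη i τ h hn

end Unfold

/-! ### Uncountable sets -/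

theorem exists_fiber_not_countable {X Y : Type*} [Countable Y] {W : Set X} (hW : ¬ W.Countable)
    (f : X → Y) : ∃ y, ¬ (W ∩ f ⁻¹' {y}).Countable := by
  by_contra! h
  refine hW ((Set.countable_iUnion h).mono fun a ha => ?_)
  exact Set.mem_iUnion.2 ⟨f a, ha, rfl⟩

/-! ### The ambient algebra -/

section Ambient

variable {F : Type*} [CommRing F] {lam : Cardinal.{0}} (s : ℕ → F) (𝔉 : Forest lam)

/-- The canonical map of the base algebra into its completion, as an algebra homomorphism. -/
def toCompletionHom : BaseAlg F 𝔉 →ₐ[F] Completion s 𝔉 where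
  toFun := toCompletion s 𝔉
  map_one' := rfl
  map_mul' _ _ := rfl
  map_zero' := rfl
  map_add' _ _ := rfl
  commutes' _ := rfl

/-- The embedding of the completion into the ambient algebra, as an algebra homomorphism. -/
def ofCompletionHom : Completion s 𝔉 →ₐ[F] Ambient s 𝔉 := Algebra.TensorProduct.includeRight

/-- The map of the base algebra into the ambient algebra, as an algebra homomorphism. -/
def ofBaseHom : BaseAlg F 𝔉 →ₐ[F] Ambient s 𝔉 := (ofCompletionHom s 𝔉).comp (toCompletionHom s 𝔉)

theorem ofBaseHom_apply (b : BaseAlg F 𝔉) : ofBaseHom s 𝔉 b = ofBase s 𝔉 b := rfl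

theorem ofCompletionHom_apply (g : Completion s 𝔉) :
    ofCompletionHom s 𝔉 g = ofCompletion s 𝔉 g := rfl

theorem toCompletionHom_apply (b : BaseAlg F 𝔉) :
    toCompletionHom s 𝔉 b = toCompletion s 𝔉 b := rfl

variable {s 𝔉}

/-- The kernel of the embedding of the completion consists of torsion elements. For pairwise coprime
`s_n` it is not zero, since the completion is then the product of the algebras `B / s_n B`. -/
theorem exists_smul_eq_zero_of_ofCompletion [IsDomain F] {g : Completion s 𝔉}
    (h : ofCompletion s 𝔉 g = 0) : ∃ f : F, f ≠ 0 ∧ f • g = 0 := by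
  obtain ⟨f, hf⟩ := (IsLocalizedModule.eq_zero_iff (nonZeroDivisors F)
    (TensorProduct.mk F (FractionRing F) (Completion s 𝔉) 1)).1 h
  exact ⟨f, nonZeroDivisors.ne_zero f.2, hf⟩

variable (s 𝔉)

theorem series_split (c : ℕ → BaseAlg F 𝔉) (n : ℕ) :
    series s 𝔉 (fun i => if n ≤ i then c i else 0) =
      toCompletion s 𝔉 (q s n • c n) + series s 𝔉 (fun i => if n + 1 ≤ i then c i else 0) := by
  refine Subtype.ext (funext fun k => ?_)
  change Ideal.Quotient.mk (qIdeal s 𝔉 k) _ =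
    Ideal.Quotient.mk (qIdeal s 𝔉 k) _ + Ideal.Quotient.mk (qIdeal s 𝔉 k) _
  have h : ∀ i, (if n ≤ i then c i else 0) =
      (if i = n then c n else 0) + (if n + 1 ≤ i then c i else 0) := fun i => by
    rcases lt_trichotomy i n with h | rfl | h
    · simp [h.ne, h.not_ge, show ¬ n + 1 ≤ i by omega]
    · simp
    · simp [h.ne', h.le, show n + 1 ≤ i by omega]
  simp only [h, smul_add, sum_add_distrib, map_add]
  congr 1
  simp only [smul_ite, smul_zero, sum_ite_eq', Finset.mem_range]
  split_ifs with hk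
  · rfl
  · rw [map_zero, eq_comm, Ideal.Quotient.eq_zero_iff_mem, Algebra.smul_def]
    refine Ideal.mul_mem_right _ _ (Ideal.mem_span_singleton.2 (map_dvd _ ?_))
    exact Nat.le_induction dvd_rfl (fun m _ hm => hm.trans (q_dvd s m)) n (not_lt.1 hk)

theorem q_ne_zero [IsDomain F] (hs0 : ∀ n, s n ≠ 0) (n : ℕ) : q s n ≠ 0 := by
  rw [q_eq_seg]; exact prod_ne_zero_iff.2 fun i _ => hs0 i

section Field

variable [IsDomain F]

theorem q_smul_y (hs0 : ∀ n, s n ≠ 0) (α : Index lam) (η : 𝔉.V α) (n : ℕ) (x : Ambient s 𝔉) :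
    q s n • y s 𝔉 α η n x = ofCompletion s 𝔉
        (series s 𝔉 fun i => if n ≤ i then X (𝔉.node α η i) else 0) +
      x * ofCompletion s 𝔉 (series s 𝔉 fun i => if n ≤ i ∧ η.1 i = true then 1 else 0) := by
  rw [y, ← algebraMap_smul (FractionRing F) (q s n), smul_inv_smul₀]
  exact (map_ne_zero_iff _ (IsFractionRing.injective F (FractionRing F))).2 (q_ne_zero s hs0 n)

theorem smul_left_cancel_ambient {f : F} (hf : f ≠ 0) {a b : Ambient s 𝔉} (h : f • a = f • b) :
    a = b := by
  rw [← algebraMap_smul (FractionRing F) f a, ← algebraMap_smul (FractionRing F) f b] at h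
  have hf' := (map_ne_zero_iff _ (IsFractionRing.injective F (FractionRing F))).2 hf
  rw [← inv_smul_smul₀ hf' a, h, inv_smul_smul₀ hf']

/-- The recursion `y_{η n x} = s_n y_{η (n+1) x} + z_{η ↾ n} + x η(n)`. -/
theorem y_eq_succ (hs0 : ∀ n, s n ≠ 0) (α : Index lam) (η : 𝔉.V α) (n : ℕ) (x : Ambient s 𝔉) :
    y s 𝔉 α η n x = s n • y s 𝔉 α η (n + 1) x +
      (z s 𝔉 (𝔉.node α η n) + if η.1 n = true then x else 0) := by
  refine smul_left_cancel_ambient s 𝔉 (q_ne_zero s hs0 n) ?_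
  have h1 := series_split s 𝔉 (fun i => X (𝔉.node α η i)) n
  have h2 := series_split s 𝔉 (fun i => if η.1 i = true then 1 else 0) n
  rw [smul_add, smul_smul, mul_comm (q s n), ← q, q_smul_y s 𝔉 hs0, q_smul_y s 𝔉 hs0]
  simp only [ite_and]
  rw [h1, h2]
  simp only [← ofCompletionHom_apply, ← toCompletionHom_apply, map_add, map_smul, mul_add,
    smul_add, z, ofBase]
  split_ifs <;> simp
  all_goals ring

theorem y_zero (hs0 : ∀ n, s n ≠ 0) (α : Index lam) (η : 𝔉.V α) (x : Ambient s 𝔉) :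
    y s 𝔉 α η 0 x = ofCompletion s 𝔉 (series s 𝔉 fun i => X (𝔉.node α η i)) +
      x * ofCompletion s 𝔉 (series s 𝔉 fun i => if η.1 i = true then 1 else 0) := by
  have := q_smul_y s 𝔉 hs0 α η 0 x
  simpa [q] using this

end Field

end Ambient

/-! ### Polynomials in the branch elements -/

section Eval

variable {F : Type*} [CommRing F] {lam : Cardinal.{0}} (s : ℕ → F) (𝔉 : Forest lam)

/-- The chosen branches of the trees of the forest. -/
abbrev Branch : Type 1 := Σ α : Index lam, 𝔉.V α

/-- The node of level `n` on a branch. -/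
def nodeOf (n : ℕ) (η : Branch 𝔉) : 𝔉.Node := 𝔉.node η.1 η.2 n

/-- The level of a node. -/
def level (τ : 𝔉.Node) : ℕ := τ.2.1.1

/-- The summand `x_α η(i)` of a branch element, where `c α` represents `x_α`. -/
def digit (c : Index lam → BaseAlg F 𝔉) (i : ℕ) (η : Branch 𝔉) : BaseAlg F 𝔉 :=
  if η.2.1 i = true then c η.1 else 0

theorem nodeOf_eq_iff {n : ℕ} {η ρ : Branch 𝔉} :
    nodeOf 𝔉 n η = nodeOf 𝔉 n ρ ↔ η.1 = ρ.1 ∧ ∀ i < n, η.2.1 i = ρ.2.1 i := by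
  obtain ⟨α, η⟩ := η
  obtain ⟨β, ρ⟩ := ρ
  constructor
  · intro h
    obtain ⟨rfl, h⟩ := Sigma.mk.inj_iff.1 h
    refine ⟨rfl, fun i hi => ?_⟩
    have h' := congrArg Subtype.val (eq_of_heq h)
    exact congrFun (eq_of_heq (Sigma.mk.inj_iff.1 h').2) ⟨i, hi⟩
  · rintro ⟨h, h'⟩
    obtain rfl : α = β := h
    have : restrict η.1 n = restrict ρ.1 n := by
      unfold restrict
      congr 1
      exact funext fun i => h' i i.2
    unfold nodeOf Forest.node
    congr 1
    exact Subtype.ext this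

variable [IsDomain F] (c : Index lam → BaseAlg F 𝔉)

/-- Evaluation at the branch elements `y_{η N x_α}` of a fixed index `N`. -/
def evalAt (N : ℕ) : MvPolynomial (Branch 𝔉) (BaseAlg F 𝔉) →+* Ambient s 𝔉 :=
  eval₂Hom (ofBaseHom s 𝔉 : BaseAlg F 𝔉 →+* Ambient s 𝔉)
    fun η => y s 𝔉 η.1 η.2 N (ofBase s 𝔉 (c η.1))

theorem evalAt_C (N : ℕ) (a : BaseAlg F 𝔉) : evalAt s 𝔉 c N (C a) = ofBase s 𝔉 a := by
  simp [evalAt, ofBaseHom_apply]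

theorem evalAt_X (N : ℕ) (η : Branch 𝔉) :
    evalAt s 𝔉 c N (X η) = y s 𝔉 η.1 η.2 N (ofBase s 𝔉 (c η.1)) := by
  simp [evalAt]

theorem evalAt_C_C (N : ℕ) (f : F) : evalAt s 𝔉 c N (C (C f)) = algebraMap F _ f := by
  rw [evalAt_C, ← ofBaseHom_apply, ← algebraMap_eq, AlgHom.commutes]

theorem evalAt_C_C_mul (N : ℕ) (f : F) (p) :
    evalAt s 𝔉 c N (C (C f) * p) = f • evalAt s 𝔉 c N p := by
  rw [map_mul, evalAt_C_C]
  exact (Algebra.smul_def f _).symm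

theorem ofBase_C {F : Type*} [CommRing F] {lam : Cardinal.{0}} (s : ℕ → F) (𝔉 : Forest lam) (f : F) : ofBase s 𝔉 (C f) = algebraMap F _ f := by
  rw [← ofBaseHom_apply, ← algebraMap_eq, AlgHom.commutes]

theorem y_eq_part (hs0 : ∀ n, s n ≠ 0) {N L : ℕ} (h : N ≤ L) (η : Branch 𝔉) :
    y s 𝔉 η.1 η.2 N (ofBase s 𝔉 (c η.1)) =
      seg s N L • y s 𝔉 η.1 η.2 L (ofBase s 𝔉 (c η.1)) +
        ofBase s 𝔉 (part s (nodeOf 𝔉) (digit 𝔉 c) N L η) := by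
  induction L, h using Nat.le_induction with
  | base => simp [seg, part, ← ofBaseHom_apply]
  | succ n hn ih =>
    rw [ih, y_eq_succ s 𝔉 hs0 η.1 η.2 n, part_succ _ _ _ hn, seg_succ s hn]
    simp only [← ofBaseHom_apply, map_add, map_mul, smul_add, mul_add, z, smul_smul]
    simp only [ofBaseHom_apply, ofBase_C, ← Algebra.smul_def, nodeOf, digit]
    split_ifs
    · abel
    · simp [← ofBaseHom_apply]; abel

theorem evalAt_shift (hs0 : ∀ n, s n ≠ 0) {N L : ℕ} (h : N ≤ L) (p) :
    evalAt s 𝔉 c L (shift s (nodeOf 𝔉) (digit 𝔉 c) N L p) = evalAt s 𝔉 c N p := by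
  have : (evalAt s 𝔉 c L).comp (shift s (nodeOf 𝔉) (digit 𝔉 c) N L) = evalAt s 𝔉 c N := by
    apply MvPolynomial.ringHom_ext
    · intro a
      simp [shift, evalAt_C]
    · intro η
      rw [RingHom.comp_apply, evalAt_X, y_eq_part s 𝔉 c hs0 h, shift, eval₂Hom_X', RingHom.map_add,
        evalAt_C_C_mul, evalAt_X, evalAt_C]
  exact DFunLike.congr_fun this p

/-- Modulo `q_k`, a polynomial in the branch elements of index `0` is a polynomial in their partial
sums. -/
theorem exists_completion_evalAt_zero (hs0 : ∀ n, s n ≠ 0) (p) : ∃ g : Completion s 𝔉,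
    evalAt s 𝔉 c 0 p = ofCompletion s 𝔉 g ∧ ∀ k, g.1 k =
      Ideal.Quotient.mk (qIdeal s 𝔉 k) (eval (part s (nodeOf 𝔉) (digit 𝔉 c) 0 k) p) := by
  let Ŷ : Branch 𝔉 → Completion s 𝔉 := fun η => series s 𝔉 (fun i => X (𝔉.node η.1 η.2 i)) +
    toCompletion s 𝔉 (c η.1) * series s 𝔉 fun i => if η.2.1 i = true then 1 else 0
  let φ := eval₂Hom (toCompletionHom s 𝔉 : BaseAlg F 𝔉 →+* Completion s 𝔉) Ŷ
  refine ⟨φ p, ?_, fun k => ?_⟩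
  · have : evalAt s 𝔉 c 0 = (ofCompletionHom s 𝔉 : Completion s 𝔉 →+* Ambient s 𝔉).comp φ := by
      apply MvPolynomial.ringHom_ext
      · intro a
        simp [φ, evalAt_C, ofBase, ofCompletionHom_apply, toCompletionHom_apply]
      · intro η
        rw [RingHom.comp_apply, evalAt_X, y_zero s 𝔉 hs0, eval₂Hom_X']
        exact ((congrArg _ (map_mul (ofCompletionHom s 𝔉) _ _).symm).trans
          (map_add (ofCompletionHom s 𝔉) _ _).symm)
    exact DFunLike.congr_fun this p
  · let π : Completion s 𝔉 →+* BaseAlg F 𝔉 ⧸ qIdeal s 𝔉 k :=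
      (Pi.evalRingHom _ k).comp (Completion s 𝔉).val.toRingHom
    have : π.comp φ = (Ideal.Quotient.mk (qIdeal s 𝔉 k)).comp
        (eval (part s (nodeOf 𝔉) (digit 𝔉 c) 0 k)) := by
      apply MvPolynomial.ringHom_ext
      · intro a
        simp only [φ, RingHom.comp_apply, eval₂Hom_C, eval_C]
        rfl
      · intro η
        simp only [φ, RingHom.comp_apply, eval₂Hom_X', eval_X]
        change Ideal.Quotient.mk (qIdeal s 𝔉 k) _ +
          Ideal.Quotient.mk (qIdeal s 𝔉 k) _ * Ideal.Quotient.mk (qIdeal s 𝔉 k) _ = _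
        rw [← map_mul, ← map_add]
        congr 1
        rw [part, mul_sum, ← sum_add_distrib, range_eq_Ico]
        refine sum_congr rfl fun i _ => ?_
        simp only [nodeOf, digit, q_eq_seg, smul_eq_C_mul]
        split_ifs <;> ring
    exact DFunLike.congr_fun this p

end Eval

/-! ### Algebraic independence of nodes and branch elements -/

section Independence

variable {F : Type*} [CommRing F] {lam : Cardinal.{0}} {𝔉 : Forest lam}

/-- No node of level `n` occurs in the coefficients of `p`, or in the elements `c α` that belong to
the branches in `p`. -/
structure AvoidsLevel (c : Index lam → BaseAlg F 𝔉) (n : ℕ)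
    (p : MvPolynomial (Branch 𝔉) (BaseAlg F 𝔉)) : Prop where
  coeff : ∀ m, ∀ τ ∈ (p.coeff m).vars, level 𝔉 τ ≠ n
  digit : ∀ η ∈ p.vars, ∀ τ ∈ (c η.1).vars, level 𝔉 τ ≠ n

theorem eventually_level_ne (S : Finset 𝔉.Node) :
    ∀ᶠ n in Filter.atTop, ∀ τ ∈ S, level 𝔉 τ ≠ n := by
  rw [Filter.eventually_all_finset]
  intro τ _
  filter_upwards [Filter.eventually_gt_atTop (level 𝔉 τ)] with n hn using hn.ne

theorem eventually_avoidsLevel (c : Index lam → BaseAlg F 𝔉)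
    (p : MvPolynomial (Branch 𝔉) (BaseAlg F 𝔉)) :
    ∀ᶠ n in Filter.atTop, AvoidsLevel c n p := by
  have h1 : ∀ᶠ n in Filter.atTop, ∀ m ∈ p.support, ∀ τ ∈ (p.coeff m).vars, level 𝔉 τ ≠ n :=
    (Filter.eventually_all_finset _).2 fun m _ => eventually_level_ne _
  have h2 : ∀ᶠ n in Filter.atTop, ∀ η ∈ p.vars, ∀ τ ∈ (c η.1).vars, level 𝔉 τ ≠ n :=
    (Filter.eventually_all_finset _).2 fun η _ => eventually_level_ne _
  filter_upwards [h1, h2] with n h1 h2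
  refine ⟨fun m τ hτ => h1 m (mem_support_iff.2 fun h => ?_) τ hτ, h2⟩
  rw [h] at hτ
  simp at hτ

theorem AvoidsLevel.sub {c : Index lam → BaseAlg F 𝔉} {n : ℕ}
    {p p' : MvPolynomial (Branch 𝔉) (BaseAlg F 𝔉)} (h : AvoidsLevel c n p)
    (h' : AvoidsLevel c n p') : AvoidsLevel c n (p - p') := by
  classical
  constructor
  · intro m τ hτ
    rw [coeff_sub] at hτ
    rcases Finset.mem_union.1 (vars_sub_subset _ hτ) with hτ | hτ
    exacts [h.coeff m τ hτ, h'.coeff m τ hτ]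
  · intro η hη
    rcases Finset.mem_union.1 (vars_sub_subset _ hη) with hη | hη
    exacts [h.digit η hη, h'.digit η hη]

theorem vars_C_mul_subset {σ A : Type*} [CommRing A] (a : A) (p : MvPolynomial σ A) :
    (C a * p).vars ⊆ p.vars := by
  classical
  refine (vars_mul _ _).trans ?_
  simp

theorem AvoidsLevel.C_C_mul {c : Index lam → BaseAlg F 𝔉} {n : ℕ} (f : F)
    {p : MvPolynomial (Branch 𝔉) (BaseAlg F 𝔉)} (h : AvoidsLevel c n p) :
    AvoidsLevel c n (C (C f) * p) := by
  constructor
  · intro m τ hτ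
    rw [coeff_C_mul] at hτ
    exact h.coeff m τ (vars_C_mul_subset _ _ hτ)
  · exact fun η hη => h.digit η (vars_C_mul_subset _ _ hη)

theorem AvoidsLevel.digit' {c : Index lam → BaseAlg F 𝔉} {n : ℕ}
    {p : MvPolynomial (Branch 𝔉) (BaseAlg F 𝔉)} (h : AvoidsLevel c n p) :
    ∀ η ∈ p.vars, ∀ i, ∀ τ ∈ (ERing.digit 𝔉 c i η).vars, level 𝔉 τ ≠ n := by
  intro η hη i τ hτ
  unfold ERing.digit at hτ
  split_ifs at hτ
  · exact h.digit η hη τ hτ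
  · simp at hτ

/-- Finitely many branches are separated by their nodes of any large enough level. -/
theorem eventually_injOn_nodeOf (S : Set (Branch 𝔉)) (hS : S.Finite) :
    ∀ᶠ n in Filter.atTop, Set.InjOn (nodeOf 𝔉 n) S := by
  have : ∀ᶠ n in Filter.atTop, ∀ η ∈ hS.toFinset, ∀ ρ ∈ hS.toFinset,
      nodeOf 𝔉 n η = nodeOf 𝔉 n ρ → η = ρ := by
    refine (Filter.eventually_all_finset _).2 fun η _ => (Filter.eventually_all_finset _).2
      fun ρ _ => ?_
    by_cases h : η = ρ
    · simp [h]
    obtain ⟨α, η⟩ := η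
    obtain ⟨β, ρ⟩ := ρ
    by_cases hαβ : α = β
    · subst hαβ
      have : ∃ i, η.1 i ≠ ρ.1 i := by
        by_contra! h'
        exact h (by rw [Subtype.ext (funext h')])
      obtain ⟨i, hi⟩ := this
      filter_upwards [Filter.eventually_gt_atTop i] with n hn h'
      exact absurd (((nodeOf_eq_iff 𝔉).1 h').2 i hn) hi
    · exact Filter.Eventually.of_forall fun n h' => absurd ((nodeOf_eq_iff 𝔉).1 h').1 hαβ
  filter_upwards [this] with n hn η hη ρ hρ
  exact hn η (hS.mem_toFinset.2 hη) ρ (hS.mem_toFinset.2 hρ)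

theorem mul_C_sub_one_mem {J : Ideal (BaseAlg F 𝔉)} {s : ℕ → F} {n : ℕ} (hJ : C (s n) ∈ J)
    {a : F} (h : IsCoprime a (s n)) : ∃ u : F, C (u * a) - 1 ∈ J := by
  obtain ⟨u, v, huv⟩ := h
  refine ⟨u, ?_⟩
  rw [eq_sub_of_add_eq huv, C_sub, C_mul, C_1, sub_sub_cancel_left]
  exact J.neg_mem (Ideal.mul_mem_left _ _ hJ)

variable [IsDomain F] (s : ℕ → F) (c : Index lam → BaseAlg F 𝔉)

theorem exists_C_C_mul_eq_shift (hs0 : ∀ n, s n ≠ 0) (N : ℕ)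
    (p : MvPolynomial (Branch 𝔉) (BaseAlg F 𝔉)) : ∃ d : F, d ≠ 0 ∧
      ∃ p', C (C d) * p = shift s (nodeOf 𝔉) (digit 𝔉 c) 0 N p' := by
  induction p using MvPolynomial.induction_on with
  | C a => exact ⟨1, one_ne_zero, C a, by simp [shift]⟩
  | add p r hp hr =>
    obtain ⟨d, hd, p', hp⟩ := hp
    obtain ⟨e, he, r', hr⟩ := hr
    refine ⟨d * e, mul_ne_zero hd he, C (C e) * p' + C (C d) * r', ?_⟩
    rw [RingHom.map_add, RingHom.map_mul _ (C (C e)), RingHom.map_mul _ (C (C d)), ← hp, ← hr]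
    simp only [shift, eval₂Hom_C, C_mul]
    ring
  | mul_X p η hp =>
    obtain ⟨d, hd, p', hp⟩ := hp
    refine ⟨d * seg s 0 N, mul_ne_zero hd (prod_ne_zero_iff.2 fun i _ => hs0 i),
      p' * (X η - C (part s (nodeOf 𝔉) (digit 𝔉 c) 0 N η)), ?_⟩
    rw [RingHom.map_mul _ p', ← hp]
    simp only [shift, map_sub, eval₂Hom_C, eval₂Hom_X', C_mul]
    ring

variable [IsPrincipalIdealRing F]

theorem evalAt_zero_injective (hu : ∀ n, ¬ IsUnit (s n))
    (hs : ∀ n m, n ≠ m → IsCoprime (s n) (s m)) {p} (h : evalAt s 𝔉 c 0 p = 0) : p = 0 := by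
  obtain ⟨g, hg, hgk⟩ := exists_completion_evalAt_zero s 𝔉 c (seq_ne_zero hu hs) p
  obtain ⟨f, hf, hfg⟩ := exists_smul_eq_zero_of_ofCompletion (hg.symm.trans h)
  by_contra hp
  obtain ⟨m, hm⟩ := ne_zero_iff.1 hp
  obtain ⟨m', hm'⟩ := ne_zero_iff.1 hm
  obtain ⟨n, hn1, hn2, hn3, hn4⟩ := ((eventually_isCoprime hs hf).and
    ((eventually_not_dvd hu hs hm').and ((eventually_avoidsLevel c p).and
      (eventually_injOn_nodeOf (p.vars ∪ m.support : Set (Branch 𝔉)) (Set.toFinite _))))).exists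
  set J : Ideal (BaseAlg F 𝔉) := Ideal.span {C (s n)} with hJ
  have hsJ : C (s n) ∈ J := Ideal.mem_span_singleton_self _
  have hev : eval (part s (nodeOf 𝔉) (digit 𝔉 c) 0 (n + 1)) p ∈ J := by
    have h1 : C f * eval (part s (nodeOf 𝔉) (digit 𝔉 c) 0 (n + 1)) p ∈ J := by
      have h2 : f • g.1 (n + 1) = 0 := congrFun (congrArg Subtype.val hfg) (n + 1)
      rw [hgk] at h2
      have h3 : C f * eval (part s (nodeOf 𝔉) (digit 𝔉 c) 0 (n + 1)) p ∈ qIdeal s 𝔉 (n + 1) := by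
        rw [← smul_eq_C_mul]
        exact Ideal.Quotient.eq_zero_iff_mem.1 h2
      refine (Ideal.span_singleton_le_span_singleton.2 ?_ : qIdeal s 𝔉 (n + 1) ≤ J) h3
      exact map_dvd _ (Dvd.intro _ rfl)
    obtain ⟨a, b, hab⟩ := hn1
    have h4 : eval (part s (nodeOf 𝔉) (digit 𝔉 c) 0 (n + 1)) p =
        C b * (C f * eval (part s (nodeOf 𝔉) (digit 𝔉 c) 0 (n + 1)) p) +
        (C a * eval (part s (nodeOf 𝔉) (digit 𝔉 c) 0 (n + 1)) p) * C (s n) := by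
      have : (C a * C (s n) + C b * C f : BaseAlg F 𝔉) = 1 := by
        rw [← C_mul, ← C_mul, ← C_add, hab, C_1]
      linear_combination - eval (part s (nodeOf 𝔉) (digit 𝔉 c) 0 (n + 1)) p * this
    rw [h4]
    exact J.add_mem (J.mul_mem_left _ h1) (J.mul_mem_left _ hsJ)
  obtain ⟨u, hu'⟩ := mul_C_sub_one_mem hsJ (isCoprime_seg hs 0 n)
  -- Since the branches in `p` have distinct nodes of level `n`, their digits at `n` may be
  -- regarded as functions of these nodes.
  let t : Branch 𝔉 → BaseAlg F 𝔉 := fun η =>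
    C u * (part s (nodeOf 𝔉) (digit 𝔉 c) 0 n η + C (seg s 0 n) * digit 𝔉 c n η)
  have hinj : Set.InjOn (nodeOf 𝔉 n) (p.vars : Set (Branch 𝔉)) :=
    hn4.mono Set.subset_union_left
  have hw : ∀ η ∈ p.vars, C (seg s 0 n) *
      Function.extend (fun η : p.vars => nodeOf 𝔉 n η) (fun η => t η) 0 (nodeOf 𝔉 n η) -
      (part s (nodeOf 𝔉) (digit 𝔉 c) 0 n η + C (seg s 0 n) * digit 𝔉 c n η) ∈ J := by
    intro η hη
    have hi : Function.Injective (fun η : p.vars => nodeOf 𝔉 n η) :=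
      fun a b hab => Subtype.ext (hinj a.2 b.2 hab)
    rw [hi.extend_apply (fun η => t η) 0 ⟨η, hη⟩]
    convert J.mul_mem_left
      (part s (nodeOf 𝔉) (digit 𝔉 c) 0 n η + C (seg s 0 n) * digit 𝔉 c n η) hu' using 1
    simp only [t, C_mul]
    ring
  have key := rename_mem_map_C s (nodeOf 𝔉) (digit 𝔉 c) (Nat.zero_le n) hsJ (level 𝔉)
    (fun _ _ => rfl) hn3.coeff hn3.digit' hu' _ hw hev
  have h5 := MvPolynomial.mem_map_C_iff.1 key (m.mapDomain (nodeOf 𝔉 n))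
  rw [coeff_rename_mapDomain_of_injOn _ _ _ hn4, hJ, Ideal.mem_span_singleton,
    C_dvd_iff_dvd_coeff] at h5
  exact hn2 (h5 m')

/-- The nodes `z_τ` and the branch elements `y_{η N x_α}` of a fixed index `N` are algebraically
independent. -/
theorem evalAt_injective (hu : ∀ n, ¬ IsUnit (s n))
    (hs : ∀ n m, n ≠ m → IsCoprime (s n) (s m)) (N : ℕ) :
    Function.Injective (evalAt s 𝔉 c N) := by
  rw [injective_iff_map_eq_zero]
  intro p hp
  have hs0 := seq_ne_zero hu hs
  obtain ⟨d, hd, p', hp'⟩ := exists_C_C_mul_eq_shift s c hs0 N p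
  have : p' = 0 := by
    refine evalAt_zero_injective s c hu hs ?_
    rw [← evalAt_shift s 𝔉 c hs0 (Nat.zero_le N), ← hp', evalAt_C_C_mul, hp, smul_zero]
  rw [this, map_zero] at hp'
  refine (mul_eq_zero.1 hp').resolve_left fun h => hd ?_
  rwa [C_eq_zero, C_eq_zero] at h

theorem ofBase_injective (hu : ∀ n, ¬ IsUnit (s n))
    (hs : ∀ n m, n ≠ m → IsCoprime (s n) (s m)) : Function.Injective (ofBase s 𝔉) := by
  intro a b h
  rw [← evalAt_C s 𝔉 (fun _ => 0) 0 a, ← evalAt_C s 𝔉 (fun _ => 0) 0 b] at h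
  exact C_injective _ _ (evalAt_injective s _ hu hs 0 h)

theorem eval_part_mem_of_evalAt (hu : ∀ n, ¬ IsUnit (s n))
    (hs : ∀ n m, n ≠ m → IsCoprime (s n) (s m)) {N n L : ℕ} (hN : N ≤ n) {p p'}
    (h : evalAt s 𝔉 c N p = s n • evalAt s 𝔉 c L p') :
    eval (part s (nodeOf 𝔉) (digit 𝔉 c) N (n + 1)) p ∈
      Ideal.span {(C (s n) : BaseAlg F 𝔉)} := by
  have hs0 := seq_ne_zero hu hs
  have h1 : n + 1 ≤ max L (n + 1) := le_max_right _ _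
  refine eval_part_mem_of_shift s _ _ hN h1
    (p' := shift s (nodeOf 𝔉) (digit 𝔉 c) L (max L (n + 1)) p') ?_
  refine evalAt_injective s c hu hs (max L (n + 1)) ?_
  rw [evalAt_C_C_mul, evalAt_shift s 𝔉 c hs0 (by omega), evalAt_shift s 𝔉 c hs0 (le_max_left _ _), h]

end Independence

/-! ### Functoriality of the ambient algebra -/

section Functoriality

variable {F : Type*} [CommRing F] {lam : Cardinal.{0}} (s : ℕ → F) (𝔉 : Forest lam)
  (φ : BaseAlg F 𝔉 →ₐ[F] BaseAlg F 𝔉)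

theorem qIdeal_le_comap (n : ℕ) : qIdeal s 𝔉 n ≤
    (qIdeal s 𝔉 n).comap φ := by
  rw [qIdeal, Ideal.span_singleton_le_iff_mem, Ideal.mem_comap, AlgHom.commutes]
  exact Ideal.mem_span_singleton_self _

theorem quotientMap_mk_apply {A : Type*} [CommRing A] [Algebra F A] {I J : Ideal A} (φ : A →ₐ[F] A)
    (h : I ≤ J.comap φ) (b : A) :
    Ideal.quotientMapₐ J φ h (Ideal.Quotient.mk I b) = Ideal.Quotient.mk J (φ b) := rfl

theorem factor_quotientMap (n : ℕ) (a : BaseAlg F 𝔉 ⧸ qIdeal s 𝔉 (n + 1)) :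
    Ideal.Quotient.factor (qIdeal_succ_le s 𝔉 n)
      (Ideal.quotientMapₐ _ φ (qIdeal_le_comap s 𝔉 φ (n + 1)) a) =
    Ideal.quotientMapₐ _ φ (qIdeal_le_comap s 𝔉 φ n)
      (Ideal.Quotient.factor (qIdeal_succ_le s 𝔉 n) a) := by
  obtain ⟨b, rfl⟩ := Ideal.Quotient.mk_surjective a
  rw [quotientMap_mk_apply, Ideal.Quotient.factor_mk, Ideal.Quotient.factor_mk,
    quotientMap_mk_apply]

/-- The coordinatewise extension of an endomorphism of the base algebra to the product of the
algebras `B / q_n B`. -/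
def productMap : (∀ n, BaseAlg F 𝔉 ⧸ qIdeal s 𝔉 n) →ₐ[F] (∀ n, BaseAlg F 𝔉 ⧸ qIdeal s 𝔉 n) :=
  AlgHom.pi fun n => (Ideal.quotientMapₐ _ φ (qIdeal_le_comap s 𝔉 φ n)).comp (Pi.evalAlgHom F _ n)

theorem productMap_mem (g : Completion s 𝔉) : productMap s 𝔉 φ g.1 ∈ Completion s 𝔉 := by
  intro n
  have h := factor_quotientMap s 𝔉 φ n (g.1 (n + 1))
  rw [g.2 n] at h
  exact h

/-- The extension of an endomorphism of the base algebra to the completion. -/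
def completionMap : Completion s 𝔉 →ₐ[F] Completion s 𝔉 :=
  ((productMap s 𝔉 φ).comp (Completion s 𝔉).val).codRestrict _ (productMap_mem s 𝔉 φ)

theorem completionMap_series (a : ℕ → BaseAlg F 𝔉) :
    completionMap s 𝔉 φ (series s 𝔉 a) = series s 𝔉 fun i => φ (a i) := by
  refine Subtype.ext (funext fun k => ?_)
  refine (quotientMap_mk_apply φ (qIdeal_le_comap s 𝔉 φ k) _).trans ?_
  rw [map_sum]
  simp only [map_smul]
  rfl

theorem completionMap_toCompletion (b : BaseAlg F 𝔉) :
    completionMap s 𝔉 φ (toCompletion s 𝔉 b) = toCompletion s 𝔉 (φ b) :=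
  Subtype.ext (funext fun k => quotientMap_mk_apply φ (qIdeal_le_comap s 𝔉 φ k) _)

/-- The extension of an endomorphism of the base algebra to the ambient algebra. -/
def ambientMap : Ambient s 𝔉 →ₐ[FractionRing F] Ambient s 𝔉 :=
  Algebra.TensorProduct.map (AlgHom.id (FractionRing F) (FractionRing F)) (completionMap s 𝔉 φ)

theorem ambientMap_ofCompletion (g : Completion s 𝔉) :
    ambientMap s 𝔉 φ (ofCompletion s 𝔉 g) = ofCompletion s 𝔉 (completionMap s 𝔉 φ g) := by
  simp [ambientMap, ofCompletion]

theorem ambientMap_ofBase (b : BaseAlg F 𝔉) :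
    ambientMap s 𝔉 φ (ofBase s 𝔉 b) = ofBase s 𝔉 (φ b) := by
  rw [ofBase, ambientMap_ofCompletion, completionMap_toCompletion]
  rfl

theorem ambientMap_y [IsDomain F] (α : Index lam) (η : 𝔉.V α) (n : ℕ) (x : Ambient s 𝔉) :
    ambientMap s 𝔉 φ (y s 𝔉 α η n x) = (algebraMap F (FractionRing F) (q s n))⁻¹ •
      (ofCompletion s 𝔉 (series s 𝔉 fun i => if n ≤ i then φ (X (𝔉.node α η i)) else 0) +
        ambientMap s 𝔉 φ x * ofCompletion s 𝔉
          (series s 𝔉 fun i => if n ≤ i ∧ η.1 i = true then 1 else 0)) := by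
  rw [y, map_smul, map_add, map_mul, ambientMap_ofCompletion, ambientMap_ofCompletion,
    completionMap_series, completionMap_series]
  simp only [apply_ite φ, map_zero, map_one]

end Functoriality

/-! ### The chain -/

section Chain

variable {F : Type*} [CommRing F] [IsDomain F] {lam : Cardinal.{0}} (s : ℕ → F) (𝔉 : Forest lam)
  (b : Index lam → BaseAlg F 𝔉)

theorem chain_zero : chain s 𝔉 b 0 = ⊥ := Ordinal.limitRecOn_zero _ _ _

theorem chain_one : chain s 𝔉 b (0 + 1) = Subalgebra.toSubmodule ⊥ := by
  rw [chain, Ordinal.limitRecOn_add_one, if_pos rfl]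

theorem chain_add_one {o : Ordinal.{0}} (h0 : o ≠ 0) (h : o < lam.ord) : chain s 𝔉 b (o + 1) =
    Subalgebra.toSubmodule (Algebra.adjoin F
      ((chain s 𝔉 b o : Set (Ambient s 𝔉)) ∪ gens s 𝔉 ⟨o, h⟩ (x s 𝔉 b ⟨o, h⟩))) := by
  rw [chain, Ordinal.limitRecOn_add_one, if_neg h0, dif_pos h]
  rfl

theorem chain_add_one_of_le {o : Ordinal.{0}} (h0 : o ≠ 0) (h : ¬ o < lam.ord) :
    chain s 𝔉 b (o + 1) = chain s 𝔉 b o := by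
  rw [chain, Ordinal.limitRecOn_add_one, if_neg h0, dif_neg h]
  rfl

theorem chain_limit {o : Ordinal.{0}} (h : Order.IsSuccLimit o) :
    chain s 𝔉 b o = ⨆ (β : Ordinal.{0}) (_ : β < o), chain s 𝔉 b β :=
  Ordinal.limitRecOn_limit _ _ _ _ h

theorem x_mem_chain (α : Index lam) : x s 𝔉 b α ∈ chain s 𝔉 b α.1 := by
  unfold x xOf
  split_ifs with h
  · exact h.1
  · exact zero_mem _

variable {s 𝔉 b} in
theorem x_eq_of_ne_zero {α : Index lam} (h : x s 𝔉 b α ≠ 0) : x s 𝔉 b α = ofBase s 𝔉 (b α) := by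
  unfold x xOf at h ⊢
  split_ifs at h ⊢
  · rfl
  · exact absurd rfl h

theorem exists_x_eq (α : Index lam) : ∃ c : BaseAlg F 𝔉, x s 𝔉 b α = ofBase s 𝔉 c := by
  by_cases h : x s 𝔉 b α = 0
  · exact ⟨0, by rw [h, ← ofBaseHom_apply, map_zero]⟩
  · exact ⟨_, x_eq_of_ne_zero h⟩

theorem chain_le_add_one (o : Ordinal.{0}) : chain s 𝔉 b o ≤ chain s 𝔉 b (o + 1) := by
  by_cases h0 : o = 0
  · rw [h0, chain_zero]
    exact bot_le
  by_cases h : o < lam.ord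
  · rw [chain_add_one s 𝔉 b h0 h]
    exact fun a ha => Algebra.subset_adjoin (Or.inl ha)
  · rw [chain_add_one_of_le s 𝔉 b h0 h]

theorem chain_mono : Monotone (chain s 𝔉 b) := by
  intro β o
  induction o using Ordinal.limitRecOn with
  | zero => intro h; rw [nonpos_iff_eq_zero.1 h]
  | add_one o ih =>
    intro h
    rcases h.eq_or_lt with rfl | h
    · exact le_rfl
    · exact (ih (Order.lt_add_one_iff.1 h)).trans (chain_le_add_one s 𝔉 b o)
  | limit o ho ih =>
    intro h
    rcases h.eq_or_lt with rfl | h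
    · exact le_rfl
    · rw [chain_limit s 𝔉 b ho]
      exact le_iSup₂_of_le β h le_rfl

/-- Induction along the chain: a subalgebra that contains the generators of each step, provided that
it contains `x_α`, contains the whole chain. -/
theorem chain_le_of_gens_subset (A : Subalgebra F (Ambient s 𝔉))
    (hA : ∀ α : Index lam, α.1 ≠ 0 → x s 𝔉 b α ∈ A → gens s 𝔉 α (x s 𝔉 b α) ⊆ A)
    (o : Ordinal.{0}) : chain s 𝔉 b o ≤ Subalgebra.toSubmodule A := by
  induction o using Ordinal.limitRecOn with
  | zero => rw [chain_zero]; exact bot_le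
  | add_one o ih =>
    by_cases h0 : o = 0
    · rw [h0, chain_one]
      exact OrderHomClass.mono _ bot_le
    by_cases h : o < lam.ord
    · rw [chain_add_one s 𝔉 b h0 h]
      refine fun a ha => Algebra.adjoin_le (Set.union_subset ih ?_) ha
      exact hA ⟨o, h⟩ h0 (ih (x_mem_chain s 𝔉 b ⟨o, h⟩))
    · rw [chain_add_one_of_le s 𝔉 b h0 h]
      exact ih
  | limit o ho ih =>
    rw [chain_limit s 𝔉 b ho]
    exact iSup₂_le ih

theorem mem_R_iff (hlam : Cardinal.aleph0 ≤ lam) {a : Ambient s 𝔉} :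
    a ∈ R s 𝔉 b ↔ ∃ o < lam.ord, a ∈ chain s 𝔉 b o := by
  have hl := Cardinal.isSuccLimit_ord hlam
  refine ⟨fun h => ?_, fun ⟨o, ho, h⟩ => chain_mono s 𝔉 b ho.le h⟩
  rw [R, chain_limit s 𝔉 b hl, iSup_subtype'] at h
  have : Nonempty {o // o < lam.ord} := ⟨⟨0, hl.bot_lt⟩⟩
  obtain ⟨⟨o, ho⟩, h⟩ := (Submodule.mem_iSup_of_directed
    (fun o : {o // o < lam.ord} => chain s 𝔉 b o.1) (Monotone.directed_le fun _ _ h => chain_mono s 𝔉 b h)).1 h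
  exact ⟨o, ho, h⟩

theorem one_mem_R (hlam : Cardinal.aleph0 ≤ lam) : (1 : Ambient s 𝔉) ∈ R s 𝔉 b := by
  have hl := Cardinal.isSuccLimit_ord hlam
  refine chain_mono s 𝔉 b (hl.add_one_lt hl.bot_lt).le ?_
  rw [Ordinal.bot_eq_zero, chain_one]
  exact one_mem (⊥ : Subalgebra F (Ambient s 𝔉))

theorem mul_mem_R (hlam : Cardinal.aleph0 ≤ lam) {a a' : Ambient s 𝔉} (ha : a ∈ R s 𝔉 b)
    (ha' : a' ∈ R s 𝔉 b) : a * a' ∈ R s 𝔉 b := by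
  have hl := Cardinal.isSuccLimit_ord hlam
  obtain ⟨o, ho, h⟩ := (mem_R_iff s 𝔉 b hlam).1 ha
  obtain ⟨o', ho', h'⟩ := (mem_R_iff s 𝔉 b hlam).1 ha'
  have hm : max o o' + 1 < lam.ord := hl.add_one_lt (max_lt ho ho')
  refine chain_mono s 𝔉 b (hl.add_one_lt hm).le ?_
  rw [chain_add_one s 𝔉 b (by simp) hm]
  exact Subalgebra.mul_mem _
    (Algebra.subset_adjoin (Or.inl (chain_mono s 𝔉 b ((le_max_left o o').trans le_self_add) h)))
    (Algebra.subset_adjoin (Or.inl (chain_mono s 𝔉 b ((le_max_right o o').trans le_self_add) h')))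

/-- The module `R` is a subalgebra. -/
def subalgebraR (hlam : Cardinal.aleph0 ≤ lam) : Subalgebra F (Ambient s 𝔉) :=
  (R s 𝔉 b).toSubalgebra (one_mem_R s 𝔉 b hlam) fun _ _ => mul_mem_R s 𝔉 b hlam

theorem gens_subset_R (hlam : Cardinal.aleph0 ≤ lam) {α : Index lam} (hα : α.1 ≠ 0) :
    gens s 𝔉 α (x s 𝔉 b α) ⊆ R s 𝔉 b := by
  intro a ha
  have hl := Cardinal.isSuccLimit_ord hlam
  refine chain_mono s 𝔉 b (hl.add_one_lt α.2).le ?_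
  rw [chain_add_one s 𝔉 b hα α.2]
  exact Algebra.subset_adjoin (Or.inr ha)

end Chain

/-! ### Elements of the chain as polynomials in branch elements -/

section Representation

variable {F : Type*} [CommRing F] [IsDomain F] {lam : Cardinal.{0}} (s : ℕ → F) (𝔉 : Forest lam)

/-- The algebra of all polynomials in nodes and branch elements. -/
def branchAlgebra (hs0 : ∀ n, s n ≠ 0) (c : Index lam → BaseAlg F 𝔉) :
    Subalgebra F (Ambient s 𝔉) where
  carrier := {a | ∃ N p, evalAt s 𝔉 c N p = a}
  mul_mem' := by
    rintro _ _ ⟨N, p, rfl⟩ ⟨N', p', rfl⟩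
    refine ⟨max N N', shift s (nodeOf 𝔉) (digit 𝔉 c) N (max N N') p *
      shift s (nodeOf 𝔉) (digit 𝔉 c) N' (max N N') p', ?_⟩
    rw [RingHom.map_mul, evalAt_shift s 𝔉 c hs0 (le_max_left _ _),
      evalAt_shift s 𝔉 c hs0 (le_max_right _ _)]
  add_mem' := by
    rintro _ _ ⟨N, p, rfl⟩ ⟨N', p', rfl⟩
    refine ⟨max N N', shift s (nodeOf 𝔉) (digit 𝔉 c) N (max N N') p +
      shift s (nodeOf 𝔉) (digit 𝔉 c) N' (max N N') p', ?_⟩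
    rw [RingHom.map_add, evalAt_shift s 𝔉 c hs0 (le_max_left _ _),
      evalAt_shift s 𝔉 c hs0 (le_max_right _ _)]
  algebraMap_mem' f := ⟨0, C (C f), evalAt_C_C s 𝔉 c 0 f⟩

/-- The endomorphism of the base algebra that kills the variables of the tree of index `0`, which
do not occur in `R`. -/
def killZero : BaseAlg F 𝔉 →ₐ[F] BaseAlg F 𝔉 :=
  aeval fun τ => if τ.1.1 = 0 then 0 else X τ

theorem killZero_X {F : Type*} [CommRing F] {lam : Cardinal.{0}} (𝔉 : Forest lam) (τ : 𝔉.Node) :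
    killZero 𝔉 (X τ : BaseAlg F 𝔉) = if τ.1.1 = 0 then 0 else X τ :=
  aeval_X _ _

variable (b : Index lam → BaseAlg F 𝔉)

theorem R_le_branchAlgebra (hs0 : ∀ n, s n ≠ 0) {c : Index lam → BaseAlg F 𝔉}
    (hc : ∀ α, x s 𝔉 b α = ofBase s 𝔉 (c α)) {a : Ambient s 𝔉} (ha : a ∈ R s 𝔉 b) :
    ∃ N p, evalAt s 𝔉 c N p = a := by
  refine chain_le_of_gens_subset s 𝔉 b (branchAlgebra s 𝔉 hs0 c) (fun α _ _ => ?_) _ ha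
  rintro _ (⟨η, n, rfl⟩ | ⟨τ, rfl⟩)
  · exact ⟨n, X ⟨α, η⟩, by rw [evalAt_X, hc]⟩
  · exact ⟨0, C (X ⟨α, τ⟩), evalAt_C s 𝔉 c 0 _⟩

theorem ambientMap_killZero_y {α : Index lam} (hα : α.1 ≠ 0) (η : 𝔉.V α) (n : ℕ)
    {a : Ambient s 𝔉} (ha : ambientMap s 𝔉 (killZero 𝔉) a = a) :
    ambientMap s 𝔉 (killZero 𝔉) (y s 𝔉 α η n a) = y s 𝔉 α η n a := by
  rw [ambientMap_y, ha]
  simp only [killZero_X, Forest.node, if_neg hα]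
  rfl

theorem ambientMap_killZero_of_mem_chain (o : Ordinal.{0}) {a : Ambient s 𝔉}
    (ha : a ∈ chain s 𝔉 b o) : ambientMap s 𝔉 (killZero 𝔉) a = a := by
  refine chain_le_of_gens_subset s 𝔉 b (AlgHom.equalizer
    ((ambientMap s 𝔉 (killZero 𝔉)).restrictScalars F) (AlgHom.id F _)) (fun α hα hx => ?_) _ ha
  rintro _ (⟨η, n, rfl⟩ | ⟨τ, rfl⟩)
  · exact ambientMap_killZero_y s 𝔉 hα η n hx
  · refine (ambientMap_ofBase s 𝔉 _ _).trans ?_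
    rw [killZero_X, if_neg hα]
    rfl

theorem ambientMap_killZero_x (α : Index lam) :
    ambientMap s 𝔉 (killZero 𝔉) (x s 𝔉 b α) = x s 𝔉 b α :=
  ambientMap_killZero_of_mem_chain s 𝔉 b _ (x_mem_chain s 𝔉 b α)

/-- The retraction maps every polynomial in nodes and branch elements into `R`. -/
theorem ambientMap_killZero_evalAt_mem (hlam : Cardinal.aleph0 ≤ lam)
    {c : Index lam → BaseAlg F 𝔉} (hc : ∀ α, x s 𝔉 b α = ofBase s 𝔉 (c α)) (N : ℕ) (p) :
    ambientMap s 𝔉 (killZero 𝔉) (evalAt s 𝔉 c N p) ∈ R s 𝔉 b := by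
  change _ ∈ subalgebraR s 𝔉 b hlam
  induction p using MvPolynomial.induction_on with
  | C a =>
    rw [evalAt_C, ambientMap_ofBase]
    induction a using MvPolynomial.induction_on with
    | C f =>
      rw [← algebraMap_eq, AlgHom.commutes, algebraMap_eq, ofBase_C]
      exact Subalgebra.algebraMap_mem _ f
    | add a a' h h' =>
      rw [map_add, ← ofBaseHom_apply, map_add]
      exact add_mem h h'
    | mul_X a τ h =>
      rw [map_mul, ← ofBaseHom_apply, map_mul]
      refine mul_mem h ?_
      rw [killZero_X]
      split_ifs with h0
      · rw [map_zero]
        exact zero_mem _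
      · exact gens_subset_R s 𝔉 b hlam h0 (Or.inr ⟨τ.2, rfl⟩)
  | add p p' h h' =>
    rw [RingHom.map_add, map_add]
    exact add_mem h h'
  | mul_X p η h =>
    rw [RingHom.map_mul, map_mul]
    refine mul_mem h ?_
    rw [evalAt_X, ← hc]
    by_cases h0 : η.1.1 = 0
    -- The element `x_0` belongs to `R_0 = 0`.
    · have hx : x s 𝔉 b η.1 = 0 := by
        have := x_mem_chain s 𝔉 b η.1
        rwa [h0, chain_zero, Submodule.mem_bot] at this
      rw [ambientMap_y, hx, map_zero, zero_mul, add_zero]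
      simp only [killZero_X, Forest.node, if_pos h0, ite_self]
      have : series s 𝔉 (fun _ => 0) = 0 := by
        refine Subtype.ext (funext fun k => ?_)
        change Ideal.Quotient.mk (qIdeal s 𝔉 k) _ = 0
        simp
      rw [this, ← ofCompletionHom_apply, map_zero, smul_zero]
      exact zero_mem _
    · rw [ambientMap_killZero_y s 𝔉 h0 _ _ (ambientMap_killZero_x s 𝔉 b _)]
      exact gens_subset_R s 𝔉 b hlam h0 (Or.inl ⟨_, _, rfl⟩)

end Representation

/-! ### Splitting branches -/

section Splitting

variable {F : Type*} [CommRing F] {lam : Cardinal.{0}} {𝔉 : Forest lam}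

theorem exists_split {α : Index lam} {W : Set (𝔉.V α)} (hW : ¬ W.Countable) (n₀ : ℕ) :
    ∃ η ∈ W, ∃ ρ ∈ W, ∃ n ≥ n₀, (∀ i < n, η.1 i = ρ.1 i) ∧ η.1 n = true ∧ ρ.1 n = false := by
  classical
  obtain ⟨τ, hτ⟩ := exists_fiber_not_countable hW fun η i => (η.1 (i : Fin n₀) : Bool)
  obtain ⟨η, hη, ρ, hρ, hne⟩ : Set.Nontrivial (W ∩ (fun η i => η.1 (i : Fin n₀)) ⁻¹' {τ}) := by
    rw [← Set.not_subsingleton_iff]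
    exact fun h => hτ h.finite.countable
  have hex : ∃ i, η.1 i ≠ ρ.1 i := by
    by_contra! h
    exact hne (Subtype.ext (funext h))
  have hlt : ∀ i < Nat.find hex, η.1 i = ρ.1 i := fun i hi => not_not.1 (Nat.find_min hex hi)
  have hn₀ : n₀ ≤ Nat.find hex := by
    by_contra! h
    exact Nat.find_spec hex ((congrFun hη.2 ⟨_, h⟩).trans (congrFun hρ.2 ⟨_, h⟩).symm)
  have hspec := Nat.find_spec hex
  cases h : η.1 (Nat.find hex) with
  | true =>
    refine ⟨η, hη.1, ρ, hρ.1, _, hn₀, hlt, h, ?_⟩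
    simpa [h] using hspec.symm
  | false =>
    refine ⟨ρ, hρ.1, η, hη.1, _, hn₀, fun i hi => (hlt i hi).symm, ?_, h⟩
    simpa [h] using hspec.symm

theorem mem_C_of_branch {α : Index lam} (η : 𝔉.V α) {n : ℕ} (h : η.1 n = true) : n ∈ 𝔉.C α := by
  by_contra hn
  have := 𝔉.T_subset α (𝔉.V_subset α η.2 (n + 1)) ⟨n, Nat.lt_succ_self n⟩ hn
  exact absurd (h.symm.trans this) (by simp)

/-- By almost disjointness, a branch of a tree other than `T α` takes the value `0` at all large
`n ∈ C α`. -/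
theorem eventually_digit_eq_zero (c : Index lam → BaseAlg F 𝔉) (α : Index lam)
    (S : Finset (Branch 𝔉)) : ∀ᶠ n in Filter.atTop, ∀ η ∈ S, η.1 ≠ α → n ∈ 𝔉.C α →
      digit 𝔉 c n η = 0 := by
  refine (Filter.eventually_all_finset _).2 fun η _ => ?_
  by_cases h : η.1 = α
  · exact Filter.Eventually.of_forall fun _ h' => absurd h h'
  · filter_upwards [Nat.cofinite_eq_atTop ▸
      (𝔉.C_almost_disjoint η.1 α h).eventually_cofinite_notMem] with n hn _ hα
    exact if_neg fun h1 => hn ⟨mem_C_of_branch η.2 h1, hα⟩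

theorem part_congr (s : ℕ → F) (c : Index lam → BaseAlg F 𝔉) (N : ℕ) {n : ℕ} {η ρ : Branch 𝔉}
    (h : nodeOf 𝔉 n η = nodeOf 𝔉 n ρ) :
    part s (nodeOf 𝔉) (digit 𝔉 c) N n η = part s (nodeOf 𝔉) (digit 𝔉 c) N n ρ := by
  obtain ⟨h1, h2⟩ := (nodeOf_eq_iff 𝔉).1 h
  refine sum_congr rfl fun i hi => ?_
  have hi := (Finset.mem_Ico.1 hi).2
  have h3 : nodeOf 𝔉 i η = nodeOf 𝔉 i ρ :=
    (nodeOf_eq_iff 𝔉).2 ⟨h1, fun j hj => h2 j (hj.trans hi)⟩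
  simp only [h3, digit, h2 i hi, h1]

theorem y_sub_y [IsDomain F] (s : ℕ → F) (hs0 : ∀ n, s n ≠ 0) (c : Index lam → BaseAlg F 𝔉)
    {α : Index lam} {η ρ : 𝔉.V α} {n : ℕ} (h : ∀ i < n, η.1 i = ρ.1 i) (hη : η.1 n = true)
    (hρ : ρ.1 n = false) :
    y s 𝔉 α η 0 (ofBase s 𝔉 (c α)) - y s 𝔉 α ρ 0 (ofBase s 𝔉 (c α)) =
      seg s 0 n • (ofBase s 𝔉 (c α) + s n • (y s 𝔉 α η (n + 1) (ofBase s 𝔉 (c α)) -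
        y s 𝔉 α ρ (n + 1) (ofBase s 𝔉 (c α)))) := by
  have h1 := y_eq_part s 𝔉 c hs0 (Nat.zero_le n) ⟨α, η⟩
  have h2 := y_eq_part s 𝔉 c hs0 (Nat.zero_le n) ⟨α, ρ⟩
  have hn : nodeOf 𝔉 n ⟨α, η⟩ = nodeOf 𝔉 n ⟨α, ρ⟩ := (nodeOf_eq_iff 𝔉).2 ⟨rfl, h⟩
  have hn' : 𝔉.node α η n = 𝔉.node α ρ n := hn
  rw [part_congr s c 0 hn] at h1
  dsimp only at h1 h2
  rw [h1, h2, add_sub_add_right_eq_sub, y_eq_succ s 𝔉 hs0 α η n,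
    y_eq_succ s 𝔉 hs0 α ρ n, hη, hρ, hn', if_pos rfl, if_neg Bool.false_ne_true]
  simp only [smul_add, smul_sub, smul_zero]
  abel

end Splitting

/-! ### Homomorphisms on `G_α` -/

section Main

variable {F : Type*} [CommRing F] {lam : Cardinal.{0}} {𝔉 : Forest lam}

theorem coe_map_sub_eq {E : Type*} [AddCommGroup E] [Module F E] {G R : Submodule F E}
    (h : G →ₗ[F] R) {A B X A' B' : G} {f f' : F}
    (hE : (A : E) - B = f • ((X : E) + f' • ((A' : E) - B'))) :
    (h A : E) - h B = f • ((h X : E) + f' • ((h A' - h B' : R) : E)) := by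
  have hG : A - B = f • (X + f' • (A' - B')) := Subtype.ext hE
  have hR := congrArg (fun a => (h a : E)) hG
  simpa only [map_sub, map_smul, map_add, AddSubgroupClass.coe_sub, Submodule.coe_smul,
    Submodule.coe_add] using hR

theorem Admissible.coeff_eq_one {a : BaseAlg F 𝔉} (h : Admissible a) :
    ∀ m ∈ a.support, coeff m a = 1 := by
  classical
  obtain ⟨-, -, M, rfl⟩ := h
  intro m hm
  have hmM : m ∈ M := by
    by_contra h
    refine mem_support_iff.1 hm ?_
    rw [coeff_sum]
    exact sum_eq_zero fun u hu => by
      rw [coeff_monomial, if_neg (ne_of_mem_of_not_mem hu h)]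
  rw [coeff_sum, sum_eq_single_of_mem m hmM fun u _ hu => by rw [coeff_monomial, if_neg hu],
    coeff_monomial, if_pos rfl]

variable [IsDomain F] {s : ℕ → F} {b : Index lam → BaseAlg F 𝔉}

theorem x_mem_G (hs0 : ∀ n, s n ≠ 0) {α : Index lam} (hV : ¬ (Set.univ : Set (𝔉.V α)).Countable) :
    x s 𝔉 b α ∈ G s 𝔉 b α := by
  obtain ⟨η, -, -, -, n, -, -, hη, -⟩ := exists_split hV 0
  have h := y_eq_succ s 𝔉 hs0 α η n (x s 𝔉 b α)
  rw [if_pos hη] at h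
  have h' : x s 𝔉 b α = y s 𝔉 α η n (x s 𝔉 b α) - s n • y s 𝔉 α η (n + 1) (x s 𝔉 b α) -
      z s 𝔉 (𝔉.node α η n) := by
    rw [eq_sub_iff_add_eq, eq_sub_iff_add_eq]
    conv_rhs => rw [h]
    abel
  have hy : ∀ k, y s 𝔉 α η k (x s 𝔉 b α) ∈ G s 𝔉 b α := fun k =>
    Submodule.subset_span (Or.inl ⟨η, k, rfl⟩)
  have hz : z s 𝔉 (𝔉.node α η n) ∈ G s 𝔉 b α := Submodule.subset_span (Or.inr ⟨_, rfl⟩)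
  have := Submodule.sub_mem _ (Submodule.sub_mem _ (hy n) (Submodule.smul_mem _ (s n) (hy (n + 1))))
    hz
  rwa [← h'] at this

variable [IsPrincipalIdealRing F]

/-- A congruence modulo `s_n` between elements of `R` passes to the coefficients of the polynomials
that represent them, modulo `s_n` and `x_α`, if `n ∈ C α` is large. It is applied where `p`, `p'`
and `g` represent the images of `y_{η 0 x}`, `y_{ρ 0 x}` and `x`, and the branches `η` and `ρ`
split at `n`. -/
theorem coeff_sub_coeff_mem (hu : ∀ n, ¬ IsUnit (s n))
    (hs : ∀ n m, n ≠ m → IsCoprime (s n) (s m)) (c : Index lam → BaseAlg F 𝔉) (α : Index lam)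
    {N n L : ℕ} (hN : N ≤ n) (hn : n ∈ 𝔉.C α)
    {p p' g r : MvPolynomial (Branch 𝔉) (BaseAlg F 𝔉)} (f : F)
    (h : evalAt s 𝔉 c N p - evalAt s 𝔉 c N p' =
      f • (evalAt s 𝔉 c N g + s n • evalAt s 𝔉 c L r))
    {m : Branch 𝔉 →₀ ℕ}
    (hgood : ∀ t ∈ ({p, p', g} : Set (MvPolynomial (Branch 𝔉) (BaseAlg F 𝔉))),
      AvoidsLevel c n t ∧ Set.InjOn (nodeOf 𝔉 n) (t.vars ∪ m.support : Set (Branch 𝔉)) ∧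
      ∀ η ∈ t.vars, η.1 ≠ α → n ∈ 𝔉.C α → digit 𝔉 c n η = 0) :
    coeff m p - coeff m p' - C f * coeff m g ∈ Ideal.span {C (s n), c α} := by
  classical
  set J : Ideal (BaseAlg F 𝔉) := Ideal.span {C (s n), c α}
  have hsJ : C (s n) ∈ J := Ideal.subset_span (by simp)
  have hcJ : c α ∈ J := Ideal.subset_span (by simp)
  obtain ⟨hp1, hp2, hp3⟩ := hgood p (by simp)
  obtain ⟨hp'1, hp'2, hp'3⟩ := hgood p' (by simp)
  obtain ⟨hg1, hg2, hg3⟩ := hgood g (by simp)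
  have hav : AvoidsLevel c n (p - p' - C (C f) * g) := (hp1.sub hp'1).sub (hg1.C_C_mul f)
  have hev := eval_part_mem_of_evalAt s c hu hs hN (p := p - p' - C (C f) * g) (L := L)
    (p' := C (C f) * r) (by
      rw [RingHom.map_sub, RingHom.map_sub, h, evalAt_C_C_mul, evalAt_C_C_mul, smul_add,
        add_sub_cancel_left, smul_comm])
  obtain ⟨u, hu'⟩ := mul_C_sub_one_mem hsJ (isCoprime_seg hs N n)
  have hdig : ∀ η ∈ (p - p' - C (C f) * g).vars, digit 𝔉 c n η ∈ J := by
    intro η hη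
    by_cases hα : η.1 = α
    · unfold digit
      split_ifs
      exacts [hα ▸ hcJ, J.zero_mem]
    · have : digit 𝔉 c n η = 0 := by
        rcases Finset.mem_union.1 (vars_sub_subset _ hη) with hη | hη
        · rcases Finset.mem_union.1 (vars_sub_subset _ hη) with hη | hη
          exacts [hp3 η hη hα hn, hp'3 η hη hα hn]
        · exact hg3 η (vars_C_mul_subset _ _ hη) hα hn
      rw [this]
      exact J.zero_mem
  have hft : Function.FactorsThrough
      (fun η => C u * part s (nodeOf 𝔉) (digit 𝔉 c) N n η) (nodeOf 𝔉 n) :=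
    fun η ρ hηρ => congrArg _ (part_congr s c N hηρ)
  have key := rename_mem_map_C s (nodeOf 𝔉) (digit 𝔉 c) hN hsJ (level 𝔉) (fun _ _ => rfl)
    hav.coeff hav.digit' hu' (Function.extend (nodeOf 𝔉 n)
      (fun η => C u * part s (nodeOf 𝔉) (digit 𝔉 c) N n η) 0) (fun η hη => by
        rw [hft.extend_apply]
        convert J.sub_mem (J.mul_mem_left (part s (nodeOf 𝔉) (digit 𝔉 c) N n η) hu')
          (J.mul_mem_left (C (seg s N n)) (hdig η hη)) using 1
        simp only [C_mul]
        ring) hev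
  have h5 := MvPolynomial.mem_map_C_iff.1 key (m.mapDomain (nodeOf 𝔉 n))
  rwa [map_sub, map_sub, map_mul, rename_C, coeff_sub, coeff_sub, coeff_C_mul,
    coeff_rename_mapDomain_of_injOn _ _ _ hp2, coeff_rename_mapDomain_of_injOn _ _ _ hp'2,
    coeff_rename_mapDomain_of_injOn _ _ _ hg2] at h5

/-- The image of `x` under a homomorphism is represented by a polynomial all of whose coefficients
are multiples of `x`. -/
theorem exists_evalAt_eq_dvd [Countable F] (hu : ∀ n, ¬ IsUnit (s n))
    (hs : ∀ n m, n ≠ m → IsCoprime (s n) (s m)) {α : Index lam}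
    (hV : ¬ (Set.univ : Set (𝔉.V α)).Countable) {c : Index lam → BaseAlg F 𝔉}
    (hc : ∀ α, x s 𝔉 b α = ofBase s 𝔉 (c α)) (hc0 : c α ≠ 0)
    (hc1 : ∀ m ∈ (c α).support, coeff m (c α) = 1)
    (h : G s 𝔉 b α →ₗ[F] R s 𝔉 b) (hx : x s 𝔉 b α ∈ G s 𝔉 b α) :
    ∃ N p, evalAt s 𝔉 c N p = h ⟨x s 𝔉 b α, hx⟩ ∧ C (c α) ∣ p := by
  have hs0 := seq_ne_zero hu hs
  let Y : 𝔉.V α → ℕ → G s 𝔉 b α := fun η n =>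
    ⟨y s 𝔉 α η n (x s 𝔉 b α), Submodule.subset_span (Or.inl ⟨η, n, rfl⟩)⟩
  obtain ⟨N₀, g₀, hg₀⟩ := R_le_branchAlgebra s 𝔉 b hs0 hc (h ⟨x s 𝔉 b α, hx⟩).2
  choose N₁ p₀ hp₀ using fun η => R_le_branchAlgebra s 𝔉 b hs0 hc (h (Y η 0)).2
  -- Pass to an uncountable set of branches with a common index `N`.
  obtain ⟨N', hN'⟩ := exists_fiber_not_countable hV N₁
  set N := max N₀ N'
  have hg : evalAt s 𝔉 c N (shift s (nodeOf 𝔉) (digit 𝔉 c) N₀ N g₀) = h ⟨x s 𝔉 b α, hx⟩ := by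
    rw [evalAt_shift s 𝔉 c hs0 (le_max_left _ _), hg₀]
  set g := shift s (nodeOf 𝔉) (digit 𝔉 c) N₀ N g₀
  let p : 𝔉.V α → MvPolynomial (Branch 𝔉) (BaseAlg F 𝔉) := fun η =>
    shift s (nodeOf 𝔉) (digit 𝔉 c) (N₁ η) N (p₀ η)
  have hp : ∀ η, N₁ η = N' → evalAt s 𝔉 c N (p η) = h (Y η 0) := fun η hη => by
    rw [evalAt_shift s 𝔉 c hs0 (by rw [hη]; exact le_max_right _ _), hp₀]
  refine ⟨N, g, hg, ?_⟩
  by_contra hdvd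
  rw [C_dvd_iff_dvd_coeff] at hdvd
  push Not at hdvd
  obtain ⟨m, hm⟩ := hdvd
  obtain ⟨l, hl, hlm⟩ := exists_functional hc0 hc1 hm
  -- Pass to an uncountable set of branches with a common bound `M` on the levels to avoid, and with
  -- the same value of the functional `l` at the coefficient of `m`.
  have hgood : ∀ t : MvPolynomial (Branch 𝔉) (BaseAlg F 𝔉), ∃ M, ∀ n ≥ M, AvoidsLevel c n t ∧
      Set.InjOn (nodeOf 𝔉 n) (t.vars ∪ m.support : Set (Branch 𝔉)) ∧
      ∀ η ∈ t.vars, η.1 ≠ α → n ∈ 𝔉.C α → digit 𝔉 c n η = 0 := fun t =>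
    Filter.eventually_atTop.1 ((eventually_avoidsLevel c t).and
      ((eventually_injOn_nodeOf _ (Set.toFinite _)).and (eventually_digit_eq_zero c α t.vars)))
  choose M hM using hgood
  obtain ⟨⟨M', e⟩, hMe⟩ := exists_fiber_not_countable hN' fun η => (M (p η), l (coeff m (p η)))
  obtain ⟨K, hK⟩ := Filter.eventually_atTop.1 (eventually_not_dvd hu hs hlm)
  obtain ⟨η, ⟨⟨-, hη⟩, hη'⟩, ρ, ⟨⟨-, hρ⟩, hρ'⟩, n, hn, hlt, hηn, hρn⟩ :=
    exists_split hMe (max (max N (M g)) (max M' K))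
  obtain ⟨hη1, hη2⟩ := Prod.mk_inj.1 hη'
  obtain ⟨hρ1, hρ2⟩ := Prod.mk_inj.1 hρ'
  simp only [ge_iff_le, max_le_iff] at hn
  obtain ⟨⟨hnN, hng⟩, hnM, hnK⟩ := hn
  -- Transport the relation between `y_{η 0 x}`, `y_{ρ 0 x}` and `x` by `h`.
  have hYG := y_sub_y s hs0 c hlt hηn hρn
  rw [← hc] at hYG
  have hYR := coe_map_sub_eq h (A := Y η 0) (B := Y ρ 0) (X := ⟨x s 𝔉 b α, hx⟩)
    (A' := Y η (n + 1)) (B' := Y ρ (n + 1)) hYG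
  obtain ⟨L, r, hr⟩ := R_le_branchAlgebra s 𝔉 b hs0 hc (h (Y η (n + 1)) - h (Y ρ (n + 1))).2
  have hrel : evalAt s 𝔉 c N (p η) - evalAt s 𝔉 c N (p ρ) =
      seg s 0 n • (evalAt s 𝔉 c N g + s n • evalAt s 𝔉 c L r) := by
    rw [hp η hη, hp ρ hρ, hg, hr]
    exact hYR
  have hmem := coeff_sub_coeff_mem hu hs c α hnN (mem_C_of_branch η hηn) (seg s 0 n) hrel
    (m := m) (by
      rintro t (rfl | rfl | rfl)
      · exact hM _ n (hη1 ▸ hnM)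
      · exact hM _ n (hρ1 ▸ hnM)
      · exact hM _ n hng)
  obtain ⟨a, a', haa⟩ := Ideal.mem_span_pair.1 hmem
  have hla := congrArg l haa
  rw [mul_comm a, mul_comm a', ← smul_eq_C_mul, ← smul_eq_C_mul, map_add, map_sub, map_sub,
    map_smul, map_smul, hl, add_zero, hη2, hρ2, sub_self, zero_sub, smul_eq_mul, smul_eq_mul] at hla
  refine hK n hnK ((isCoprime_seg hs 0 n).symm.dvd_of_dvd_mul_left ?_)
  exact (dvd_neg.1 ⟨_, hla.symm⟩)

end Main

end ERing

end

open ERing in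
theorem proposition4p5 {F : Type*} [CommRing F] [IsDomain F] [IsPrincipalIdealRing F] [Countable F]
    (s : ℕ → F) (hs_unit : ∀ n, ¬ IsUnit (s n)) (hs_coprime : ∀ n m, n ≠ m → IsCoprime (s n) (s m))
    (lam : Cardinal.{0}) (hlam : lam.IsRegular) (hlam_lower : Cardinal.aleph 1 ≤ lam)
    (hlam_upper : lam ≤ 2 ^ Cardinal.aleph0)
    (𝔉 : ERing.Forest lam) (b : ERing.Index lam → ERing.BaseAlg F 𝔉) (hb : ERing.IsEnumeration b)
    (α : ERing.Index lam) :
    ∃ hx : ERing.x s 𝔉 b α ∈ ERing.G s 𝔉 b α,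
      ∀ h : ERing.G s 𝔉 b α →ₗ[F] ERing.R s 𝔉 b,
        ∃ r ∈ ERing.R s 𝔉 b,
          (h ⟨ERing.x s 𝔉 b α, hx⟩ : ERing.Ambient s 𝔉) = ERing.x s 𝔉 b α * r := by
  have hs0 := seq_ne_zero hs_unit hs_coprime
  have hV : ¬ (Set.univ : Set (𝔉.V α)).Countable := by
    rw [Set.countable_univ_iff, ← Cardinal.mk_le_aleph0_iff, 𝔉.V_card, not_le]
    exact Cardinal.aleph0_lt_aleph_one.trans_le hlam_lower
  have hx : x s 𝔉 b α ∈ G s 𝔉 b α := x_mem_G hs0 hV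
  refine ⟨hx, fun h => ?_⟩
  by_cases hx0 : x s 𝔉 b α = 0
  · refine ⟨0, zero_mem _, ?_⟩
    have : (⟨x s 𝔉 b α, hx⟩ : G s 𝔉 b α) = 0 := Subtype.ext hx0
    rw [this, map_zero, mul_zero]
    rfl
  choose c hc using exists_x_eq s 𝔉 b
  have hcb : c α = b α := ofBase_injective s hs_unit hs_coprime
    ((hc α).symm.trans (x_eq_of_ne_zero hx0))
  have hadm := hcb ▸ hb.1 α
  obtain ⟨N, p, hp, a, rfl⟩ := exists_evalAt_eq_dvd hs_unit hs_coprime hV hc hadm.1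
    hadm.coeff_eq_one h hx
  -- The retraction fixes `x_α` and `h(x_α)`, and moves the quotient into `R`.
  refine ⟨ambientMap s 𝔉 (killZero 𝔉) (evalAt s 𝔉 c N a),
    ambientMap_killZero_evalAt_mem s 𝔉 b hlam.aleph0_le hc N a, ?_⟩
  rw [← ambientMap_killZero_of_mem_chain s 𝔉 b _ (h ⟨x s 𝔉 b α, hx⟩).2, ← hp, RingHom.map_mul,
    evalAt_C, ← hc, map_mul, ambientMap_killZero_x]
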